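/- Let $E$ be a finite set. A partition matroid on $E$ is given by a partition of $E$ into disjoint blocks $B_1,\dots,B_l$ and integers $0\le d_i\le |B_i|$; its independent sets are the subsets $S\subseteq E$ with $|S\cap B_i|\le d_i$ for all $i$. Let $M_1$ and $M_2$ be two partition matroids on $E$ that have a common independent set of size $r$, and suppose that no two distinct elements of $E$ lie in the same block of $M_1$ and also in the same block of $M_2$. Let $k\ge 1$ be an integer with $k\le r/3$. Consider the random walk on the common independent sets of $M_1$ and $M_2$ of size $k$ which in each step moves from $S$ as follows: choose a uniformly random element $i\in S$, and move to a uniformly random common independent set of size $k$ that contains $S\setminus\{i\}$. (This is the $(k-1)$-th down-up walk $P^{\vee}_{k-1}$ on the simplicial complex of all common independent sets with at most $k$ elements.) Then all eigenvalues of its transition matrix $P^{\vee}_{k-1}$ are real, and its second largest eigenvalue, counted with multiplicity, satisfies \[ \lambda_2(P^{\vee}_{k-1}) \le 1-\frac{1}{k^2}. \] -/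

import Mathlib

/-- A finite (abstract) simplicial complex on the ground set `E`: a collection of finite subsets
that is downward closed and contains the empty face. -/
structure FaceComplex (E : Type*) where
  /-- the faces -/
  faces : Set (Finset E)
  empty_mem : ∅ ∈ faces
  down_closed : ∀ {α β : Finset E}, β ∈ faces → α ⊆ β → α ∈ faces

namespace FaceComplex

open scoped Classical in
/-- The faces of dimension `j`, that is, the faces with `j + 1` elements. -/
noncomputable def facesOfDim {E : Type*} [Fintype E] (X : FaceComplex E) (j : ℕ) :
    Finset (Finset E) :=
  Finset.univ.filter fun α => α ∈ X.faces ∧ α.card = j + 1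

/-- The faces of dimension `j` that contain the set `σ`. -/
noncomputable def facesAbove {E : Type*} [Fintype E] [DecidableEq E] (X : FaceComplex E)
    (j : ℕ) (σ : Finset E) : Finset (Finset E) :=
  (X.facesOfDim j).filter fun β => σ ⊆ β

/-- The transition matrix of the `j`-th down-up walk on the `j`-dimensional faces: from `α`,
delete a uniformly random element `i ∈ α`, then move to a uniformly random `j`-dimensional face
that contains `α \ {i}`. -/
noncomputable def downUpWalk {E : Type*} [Fintype E] [DecidableEq E] (X : FaceComplex E) (j : ℕ) :
    Matrix {α // α ∈ X.facesOfDim j} {α // α ∈ X.facesOfDim j} ℝ :=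
  fun α β => ∑ i ∈ α.1, (1 / (α.1.card : ℝ)) *
    (if α.1.erase i ⊆ β.1 then 1 / ((X.facesAbove j (α.1.erase i)).card : ℝ) else 0)

end FaceComplex

/-- The complex of all common independent sets of two matroids with at most `k` elements. -/
def matroidIntersectionComplex {E : Type*} (M₁ M₂ : Matroid E) (k : ℕ) : FaceComplex E where
  faces := {S | M₁.Indep (S : Set E) ∧ M₂.Indep (S : Set E) ∧ S.card ≤ k}
  empty_mem := by simp
  down_closed := by
    rintro α β ⟨h₁, h₂, h₃⟩ h
    exact ⟨h₁.subset (by exact_mod_cast h), h₂.subset (by exact_mod_cast h),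
      (Finset.card_le_card h).trans h₃⟩

/-- The data of a partition matroid on the finite ground set `E`: a partition of `E` into blocks,
and for each block `B` a capacity between `0` and `|B|`. (Values of `cap` at sets that are not
blocks are irrelevant.) -/
structure PartitionMatroid (E : Type*) [Fintype E] [DecidableEq E] where
  /-- the partition of the ground set into blocks -/
  blocks : Finpartition (Finset.univ : Finset E)
  /-- the capacity of each block -/
  cap : Finset E → ℕ
  cap_le : ∀ B ∈ blocks.parts, cap B ≤ B.card

namespace PartitionMatroid

/-- A set is independent when it meets every block in at most as many elements as the capacity
of the block. -/
def IsIndep {E : Type*} [Fintype E] [DecidableEq E] (P : PartitionMatroid E) (S : Finset E) :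
    Prop :=
  ∀ B ∈ P.blocks.parts, (S ∩ B).card ≤ P.cap B

/-- Two elements belong to the same block. -/
def SameBlock {E : Type*} [Fintype E] [DecidableEq E] (P : PartitionMatroid E) (x y : E) : Prop :=
  ∃ B ∈ P.blocks.parts, x ∈ B ∧ y ∈ B

theorem isIndep_empty {E : Type*} [Fintype E] [DecidableEq E] (P : PartitionMatroid E) :
    P.IsIndep ∅ := fun B _ => by simp

theorem isIndep_subset {E : Type*} [Fintype E] [DecidableEq E] (P : PartitionMatroid E)
    {I J : Finset E} (hJ : P.IsIndep J) (hIJ : I ⊆ J) : P.IsIndep I := fun B hB =>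
  (Finset.card_le_card (Finset.inter_subset_inter_right hIJ)).trans (hJ B hB)

theorem isIndep_augment {E : Type*} [Fintype E] [DecidableEq E] (P : PartitionMatroid E)
    {I J : Finset E} (hI : P.IsIndep I) (hJ : P.IsIndep J) (h : I.card < J.card) :
    ∃ e ∈ J, e ∉ I ∧ P.IsIndep (insert e I) := by
  have key : ∀ S : Finset E, ∑ B ∈ P.blocks.parts, (S ∩ B).card = S.card := by
    intro S
    have h1 : S = P.blocks.parts.biUnion (fun B => S ∩ B) := by
      rw [← Finset.inter_biUnion]
      have h2 : P.blocks.parts.biUnion (fun B => B) = Finset.univ := P.blocks.biUnion_parts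
      rw [h2, Finset.inter_univ]
    conv_rhs => rw [h1]
    rw [Finset.card_biUnion]
    intro A hA B hB hAB
    exact (P.blocks.disjoint hA hB hAB).mono Finset.inter_subset_right Finset.inter_subset_right
  obtain ⟨B, hB, hlt⟩ : ∃ B ∈ P.blocks.parts, (I ∩ B).card < (J ∩ B).card := by
    apply Finset.exists_lt_of_sum_lt
    rw [key, key]
    exact h
  obtain ⟨e, heJ, heI⟩ := Finset.exists_mem_notMem_of_card_lt_card hlt
  rw [Finset.mem_inter] at heJ heI
  refine ⟨e, heJ.1, fun h' => heI ⟨h', heJ.2⟩, fun C hC => ?_⟩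
  by_cases hCB : C = B
  · subst hCB
    rw [Finset.insert_inter_of_mem heJ.2]
    exact (Finset.card_insert_le _ _).trans (hlt.trans_le (hJ C hC))
  · have heC : e ∉ C := fun heC =>
      Finset.disjoint_left.1 (P.blocks.disjoint hC hB hCB) heC heJ.2
    rw [Finset.insert_inter_of_notMem heC]
    exact hI C hC

/-- The matroid on the ground set `E` given by the data. -/
def toMatroid {E : Type*} [Fintype E] [DecidableEq E] (P : PartitionMatroid E) : Matroid E :=
  (IndepMatroid.ofFinset Set.univ P.IsIndep
    P.isIndep_empty
    (fun _ _ hJ hIJ => P.isIndep_subset hJ hIJ)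
    (fun _ _ hI hJ h => P.isIndep_augment hI hJ h)
    (fun _ _ => Set.subset_univ _)).matroid

theorem toMatroid_indep {E : Type*} [Fintype E] [DecidableEq E] (P : PartitionMatroid E)
    (S : Finset E) : P.toMatroid.Indep (S : Set E) ↔
      ∀ B ∈ P.blocks.parts, (S ∩ B).card ≤ P.cap B := by
  unfold toMatroid
  rw [IndepMatroid.matroid_Indep, IndepMatroid.ofFinset_indep]
  rfl

end PartitionMatroid

/-- The real eigenvalues of a square matrix, with algebraic multiplicity, in decreasing order.
When all roots of the characteristic polynomial are real, entry `i` of the list (counted from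
`0`) is the `(i + 1)`-st largest eigenvalue. -/
noncomputable def eigenvaluesDesc {n : Type*} [Fintype n] [DecidableEq n] (A : Matrix n n ℝ) :
    List ℝ :=
  A.charpoly.roots.sort (· ≥ ·)

/-! The proof controls the links of the complex spectrally and passes from local to global bounds.
Write `s = |σ|` and let `T` be a common independent set of size `r ≥ 3k`.

Base case, `s = k - 2`. The link of `σ` is a graph on the elements `x` for which `σ + x` is common
independent. Two distinct vertices are non-adjacent exactly when they are parallel over `σ` in one
of the matroids, and by the block hypothesis never in both. With `R₁`, `R₂` the indicator matrices
of the two parallelism relations (diagonal included), the adjacency matrix is therefore `J + I - R₁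
- R₂`. Both `Rᵢ` are positive semidefinite, so on vectors with sum zero the form is at most that of
`I`. Each matroid blocks at most `k - 1` elements of `T` from extending `σ + x`, so all degrees are
at least `r - 2(k - 1) ≥ k + 2`. The walk on the link then has second eigenvalue at most `1/(k + 2)
= 1/(s + 4)` (`CommonIndep.linkBound_of_card_add_two`).

Smaller `σ`. Links are connected because two vertices always have a common neighbour. Oppenheim's
map `γ ↦ γ/(1 - γ)` sends `1/(s + 5)` to `1/(s + 4)`, so the bound `1/(s + 4)` holds at every level
(`LinkBound.trickle`, `CommonIndep.linkBound`).

Local to global. Each level costs a factor `1 - 1/(s + 4) = (s + 3)/(s + 4)` in the variance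
(`LinkBound.mul_cofaceVariance_le`). The product over `s = 0, ..., k - 2` telescopes to `3/(k + 2)`,
so the spectral gap is at least `3/(k(k + 2)) ≥ 1/k²`. -/

/-! ### Spectral lemmas for symmetric matrices and weighted graphs. -/

/-- If every eigenvector of a real symmetric matrix with eigenvalue above `θ` is orthogonal to `h`,
then the Rayleigh quotient of `h` is at most `θ`. -/
theorem Matrix.IsHermitian.dotProduct_mulVec_le {V : Type*} [Fintype V] [DecidableEq V]
    {B : Matrix V V ℝ} (hB : B.IsHermitian) {θ : ℝ} {h : V → ℝ}
    (H : ∀ (u : V → ℝ) (μ : ℝ), u ≠ 0 → B.mulVec u = μ • u → θ < μ → u ⬝ᵥ h = 0) :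
    h ⬝ᵥ B.mulVec h ≤ θ * (h ⬝ᵥ h) := by
  set b := hB.eigenvectorBasis with hb
  set h' : EuclideanSpace ℝ V := WithLp.toLp 2 h with hh'
  have inner_eq : ∀ u v : EuclideanSpace ℝ V, inner ℝ u v = u.ofLp ⬝ᵥ v.ofLp := by
    intro u v
    rw [EuclideanSpace.inner_eq_star_dotProduct, dotProduct_comm]
    simp
  have e1 : h ⬝ᵥ h = ∑ i, (inner ℝ (b i) h') ^ 2 := by
    have := b.sum_inner_mul_inner h' h'
    rw [inner_eq h' h'] at this
    rw [← this]
    refine Finset.sum_congr rfl fun i _ => ?_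
    rw [real_inner_comm, sq]
  have eB : ∀ i, inner ℝ (b i) (WithLp.toLp 2 (B.mulVec h)) =
      hB.eigenvalues i * inner ℝ (b i) h' := by
    intro i
    rw [inner_eq, inner_eq]
    have hsymm : (b i).ofLp ⬝ᵥ B.mulVec h = (B.mulVec (b i).ofLp) ⬝ᵥ h := by
      rw [Matrix.dotProduct_mulVec, ← Matrix.mulVec_transpose]
      have : B.transpose = B := by simpa [Matrix.IsHermitian] using hB
      rw [this]
    change (b i).ofLp ⬝ᵥ B.mulVec h = _
    rw [hsymm, hb, hB.mulVec_eigenvectorBasis, smul_dotProduct, smul_eq_mul]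
  have e2 : h ⬝ᵥ B.mulVec h = ∑ i, hB.eigenvalues i * (inner ℝ (b i) h') ^ 2 := by
    have := b.sum_inner_mul_inner h' (WithLp.toLp 2 (B.mulVec h))
    rw [inner_eq h' _] at this
    change _ = h ⬝ᵥ B.mulVec h at this
    rw [← this]
    refine Finset.sum_congr rfl fun i _ => ?_
    rw [eB, real_inner_comm]
    ring
  rw [e1, e2, Finset.mul_sum]
  refine Finset.sum_le_sum fun i _ => ?_
  rcases le_or_gt (hB.eigenvalues i) θ with hle | hlt
  · exact mul_le_mul_of_nonneg_right hle (sq_nonneg _)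
  · have h0 := H (b i).ofLp (hB.eigenvalues i) (by
      intro h0
      have h1 := b.orthonormal.1 i
      have h2 : b i = 0 := by
        ext v
        exact congrFun h0 v
      rw [h2] at h1
      simp at h1) (hB.mulVec_eigenvectorBasis i) hlt
    have h1 : inner ℝ (b i) h' = 0 := by rw [inner_eq]; exact h0
    simp [h1]

/-- Oppenheim's trickling-down argument for a connected weighted graph: a quadratic inequality for
the random walk operator turns into a bound for its second eigenvalue. -/
theorem sum_weight_mul_le_of_trickle {V : Type*} [Fintype V] [DecidableEq V] {w : V → V → ℝ}
    (hsymm : ∀ x y, w x y = w y x) (hw : ∀ x y, 0 ≤ w x y) {d : V → ℝ}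
    (hd : ∀ x, ∑ y, w x y = d x)
    (hconn : ∀ g : V → ℝ, (∀ x y, w x y ≠ 0 → g x = g y) → ∃ c, ∀ x, d x ≠ 0 → g x = c)
    {γ : ℝ} (hγ0 : 0 ≤ γ) (hγ1 : γ < 1)
    (H : ∀ g : V → ℝ, ∑ x, ∑ y, w x y * (g x * g y) ≤
      γ * ∑ x, d x * g x ^ 2 + (1 - γ) * ∑ x, (∑ y, w x y * g y) ^ 2 / d x)
    {f : V → ℝ} (hf : ∑ x, d x * f x = 0) :
    ∑ x, ∑ y, w x y * (f x * f y) ≤ γ / (1 - γ) * ∑ x, d x * f x ^ 2 := by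
  have hd0 : ∀ x, 0 ≤ d x := fun x => hd x ▸ Finset.sum_nonneg fun y _ => hw x y
  have hwd : ∀ x y, d x = 0 → w x y = 0 := by
    intro x y h
    rw [← hd x, Finset.sum_eq_zero_iff_of_nonneg fun y _ => hw x y] at h
    exact h y (Finset.mem_univ y)
  have hwd' : ∀ x y, d y = 0 → w x y = 0 := fun x y h => by rw [hsymm, hwd y x h]
  set s : V → ℝ := fun x => √(d x) with hs
  have hss : ∀ x, s x * s x = d x := fun x => Real.mul_self_sqrt (hd0 x)
  have hs0 : ∀ x, d x ≠ 0 → s x ≠ 0 := fun x h h' => h (by rw [← hss, h', zero_mul])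
  -- The symmetrically normalised adjacency matrix, similar to the walk operator off the isolated
  -- vertices. Division by zero makes its entries vanish at isolated vertices.
  set B : Matrix V V ℝ := Matrix.of fun x y => w x y / (s x * s y) with hBdef
  have hB : B.IsHermitian := by
    ext x y
    simp only [hBdef, Matrix.conjTranspose_apply, Matrix.of_apply, star_trivial]
    rw [hsymm y x, mul_comm (s y)]
  have hBw : ∀ x y, s x * B x y * s y = w x y := by
    intro x y
    simp only [hBdef, Matrix.of_apply]
    by_cases hx : d x = 0
    · simp [hwd x y hx]
    by_cases hy : d y = 0
    · simp [hwd' x y hy]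
    have := hs0 x hx
    have := hs0 y hy
    field_simp
  have hdir : ∀ g : V → ℝ, ∑ x, ∑ y, w x y * (g x - g y) ^ 2 =
      2 * ∑ x, d x * g x ^ 2 - 2 * ∑ x, ∑ y, w x y * (g x * g y) := by
    intro g
    have h1 : ∑ x, ∑ y, w x y * g x ^ 2 = ∑ x, d x * g x ^ 2 :=
      Finset.sum_congr rfl fun x _ => by rw [← Finset.sum_mul, hd]
    have h2 : ∑ x, ∑ y, w x y * g y ^ 2 = ∑ x, d x * g x ^ 2 := by
      rw [Finset.sum_comm, ← h1]
      exact Finset.sum_congr rfl fun x _ => Finset.sum_congr rfl fun y _ => by rw [hsymm]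
    have : ∀ x y, w x y * (g x - g y) ^ 2 =
        w x y * g x ^ 2 + w x y * g y ^ 2 - 2 * (w x y * (g x * g y)) := fun x y => by ring
    simp only [this, Finset.sum_sub_distrib, Finset.sum_add_distrib, h1, h2, ← Finset.mul_sum]
    ring
  have key := hB.dotProduct_mulVec_le (θ := γ / (1 - γ)) (h := fun x => s x * f x) ?_
  · have e1 : (fun x => s x * f x) ⬝ᵥ (fun x => s x * f x) = ∑ x, d x * f x ^ 2 := by
      simp only [dotProduct]
      exact Finset.sum_congr rfl fun x _ => by rw [← hss]; ring
    have e2 : (fun x => s x * f x) ⬝ᵥ B.mulVec (fun x => s x * f x) =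
        ∑ x, ∑ y, w x y * (f x * f y) := by
      simp only [dotProduct, Matrix.mulVec, Finset.mul_sum]
      exact Finset.sum_congr rfl fun x _ => Finset.sum_congr rfl fun y _ => by rw [← hBw]; ring
    rwa [e1, e2] at key
  · intro u μ hu hBu hμ
    have hμ0 : 0 < μ := (div_nonneg hγ0 (by linarith)).trans_lt hμ
    have hux : ∀ x, ∑ y, B x y * u y = μ * u x := fun x => congrFun hBu x
    have hu0 : ∀ x, d x = 0 → u x = 0 := by
      intro x hx
      have : ∑ y, B x y * u y = 0 :=
        Finset.sum_eq_zero fun y _ => by simp [hBdef, hwd x y hx]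
      rw [hux] at this
      exact (mul_eq_zero.1 this).resolve_left hμ0.ne'
    set g : V → ℝ := fun x => u x / s x with hg
    have hug : ∀ x, u x = s x * g x := by
      intro x
      by_cases hx : d x = 0
      · have : s x = 0 := by simp [hs, hx]
        rw [hu0 x hx, this, zero_mul]
      · have := hs0 x hx
        simp only [hg]
        field_simp
    have hwg : ∀ x, ∑ y, w x y * g y = μ * (d x * g x) := by
      intro x
      calc ∑ y, w x y * g y = s x * ∑ y, B x y * u y := by
            rw [Finset.mul_sum]
            exact Finset.sum_congr rfl fun y _ => by rw [← hBw, hug]; ring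
        _ = _ := by rw [hux, hug, ← hss]; ring
    have hpos : 0 < ∑ x, d x * g x ^ 2 := by
      obtain ⟨x, hx⟩ := Function.ne_iff.1 hu
      refine Finset.sum_pos' (fun x _ => mul_nonneg (hd0 x) (sq_nonneg _)) ⟨x, Finset.mem_univ x, ?_⟩
      have : d x * g x ^ 2 = u x ^ 2 := by rw [← hss, hug]; ring
      rw [this]
      exact sq_pos_of_ne_zero hx
    have hW : ∑ x, ∑ y, w x y * (g x * g y) = μ * ∑ x, d x * g x ^ 2 := by
      rw [Finset.mul_sum]
      refine Finset.sum_congr rfl fun x _ => ?_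
      calc ∑ y, w x y * (g x * g y) = g x * ∑ y, w x y * g y := by
            rw [Finset.mul_sum]
            exact Finset.sum_congr rfl fun y _ => by ring
        _ = _ := by rw [hwg]; ring
    have hW2 : ∑ x, (∑ y, w x y * g y) ^ 2 / d x = μ ^ 2 * ∑ x, d x * g x ^ 2 := by
      rw [Finset.mul_sum]
      refine Finset.sum_congr rfl fun x _ => ?_
      rw [hwg]
      by_cases hx : d x = 0
      · simp [hx]
      · field_simp
    have hD := hdir g
    have hDnn : 0 ≤ ∑ x, ∑ y, w x y * (g x - g y) ^ 2 :=
      Finset.sum_nonneg fun x _ => Finset.sum_nonneg fun y _ => mul_nonneg (hw x y) (sq_nonneg _)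
    rw [hW] at hD
    have hμ1 : μ ≤ 1 := by
      by_contra hcon
      nlinarith
    have hHg := H g
    rw [hW, hW2] at hHg
    -- Equivalently `(μ - 1)((1 - γ)μ - γ) ≥ 0`: an eigenvalue `μ ≤ 1` above `γ/(1 - γ)` must equal
    -- `1`.
    have hquad : μ ≤ γ + (1 - γ) * μ ^ 2 := by
      by_contra hcon
      nlinarith
    have hμeq : μ = 1 := by
      by_contra hne
      have hlt : μ < 1 := lt_of_le_of_ne hμ1 hne
      rw [div_lt_iff₀ (by linarith)] at hμ
      nlinarith
    -- For `μ = 1` the Dirichlet form of `g` vanishes, so `g` is constant along edges and, by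
    -- connectivity, on all non-isolated vertices. The hypothesis on `f` then gives orthogonality.
    rw [hμeq, one_mul, sub_self] at hD
    rw [Finset.sum_eq_zero_iff_of_nonneg fun x _ =>
      Finset.sum_nonneg fun y _ => mul_nonneg (hw x y) (sq_nonneg _)] at hD
    obtain ⟨c, hc⟩ := hconn g (by
      intro x y hxy
      have h1 := hD x (Finset.mem_univ x)
      rw [Finset.sum_eq_zero_iff_of_nonneg fun y _ => mul_nonneg (hw x y) (sq_nonneg _)] at h1
      have h2 := h1 y (Finset.mem_univ y)
      have h3 := (mul_eq_zero.1 h2).resolve_left hxy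
      exact sub_eq_zero.1 (pow_eq_zero_iff two_ne_zero |>.1 h3))
    calc u ⬝ᵥ (fun x => s x * f x) = ∑ x, c * (d x * f x) := by
          refine Finset.sum_congr rfl fun x _ => ?_
          by_cases hx : d x = 0
          · simp [hu0 x hx, hx]
          · rw [hug, hc x hx, ← hss]
            ring
      _ = 0 := by rw [← Finset.mul_sum, hf, mul_zero]

/-! ### Weights and double counting in links of a uniform family. -/

section UniformFamily

variable {E : Type*} [DecidableEq E]

/-- The members of the family `X` that contain `σ`. -/
def cofaces (X : Finset (Finset E)) (σ : Finset E) : Finset (Finset E) :=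
  X.filter fun β => σ ⊆ β

/-- The weight of the vertex `x` in the link of `σ`. -/
noncomputable def linkWeight (X : Finset (Finset E)) (σ : Finset E) (x : E) : ℝ :=
  if x ∈ σ then 0 else ((cofaces X (insert x σ)).card : ℝ)

/-- The weight of the edge `x y` in the link of `σ`. -/
noncomputable def pairWeight (X : Finset (Finset E)) (σ : Finset E) (x y : E) : ℝ :=
  if x ∈ σ then 0 else linkWeight X (insert x σ) y

variable {X : Finset (Finset E)} {k : ℕ} {σ : Finset E}

theorem mem_cofaces {β : Finset E} : β ∈ cofaces X σ ↔ β ∈ X ∧ σ ⊆ β := Finset.mem_filter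

theorem linkWeight_of_mem {x : E} (h : x ∈ σ) : linkWeight X σ x = 0 := if_pos h

theorem linkWeight_of_notMem {x : E} (h : x ∉ σ) :
    linkWeight X σ x = (cofaces X (insert x σ)).card := if_neg h

theorem pairWeight_of_mem {x : E} (h : x ∈ σ) (y : E) : pairWeight X σ x y = 0 := if_pos h

theorem pairWeight_of_notMem {x : E} (h : x ∉ σ) (y : E) :
    pairWeight X σ x y = linkWeight X (insert x σ) y := if_neg h

theorem linkWeight_nonneg (x : E) : 0 ≤ linkWeight X σ x := by
  unfold linkWeight
  split_ifs <;> positivity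

theorem pairWeight_nonneg (x y : E) : 0 ≤ pairWeight X σ x y := by
  unfold pairWeight
  split_ifs
  · exact le_rfl
  · exact linkWeight_nonneg y

theorem pairWeight_eq (x y : E) : pairWeight X σ x y =
    if x ∈ σ ∨ y ∈ σ ∨ x = y then 0 else ((cofaces X (insert x (insert y σ))).card : ℝ) := by
  unfold pairWeight linkWeight
  simp only [Finset.mem_insert, Finset.insert_comm y x]
  by_cases hx : x ∈ σ <;> by_cases hy : y ∈ σ <;> by_cases hxy : x = y <;>
    simp [hx, hy, hxy, eq_comm]

theorem pairWeight_comm (x y : E) : pairWeight X σ x y = pairWeight X σ y x := by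
  rw [pairWeight_eq, pairWeight_eq, Finset.insert_comm]
  congr 1
  simp only [eq_comm, eq_iff_iff]
  tauto

/-- The unnormalised variance of `f` on the members of `X` that contain `σ`. -/
noncomputable def cofaceVariance (X : Finset (Finset E)) (f : Finset E → ℝ) (σ : Finset E) : ℝ :=
  ∑ β ∈ cofaces X σ, f β ^ 2 - (∑ β ∈ cofaces X σ, f β) ^ 2 / (cofaces X σ).card

theorem cofaceVariance_sub_const (f : Finset E → ℝ) (c : ℝ) (σ : Finset E) :
    cofaceVariance X (fun β => f β - c) σ = cofaceVariance X f σ := by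
  unfold cofaceVariance
  have : ∀ β, (f β - c) ^ 2 = f β ^ 2 - 2 * c * f β + c ^ 2 := fun β => by ring
  simp only [this, Finset.sum_add_distrib, Finset.sum_sub_distrib, ← Finset.mul_sum,
    Finset.sum_const, nsmul_eq_mul]
  rcases (cofaces X σ).eq_empty_or_nonempty with h | h
  · simp [h]
  · have : ((cofaces X σ).card : ℝ) ≠ 0 := by exact_mod_cast h.card_pos.ne'
    field_simp
    ring

variable [Fintype E]

theorem sum_cofaces_sum_sdiff (X : Finset (Finset E)) (σ : Finset E) (h : E → Finset E → ℝ) :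
    ∑ β ∈ cofaces X σ, ∑ x ∈ β \ σ, h x β =
      ∑ x, if x ∈ σ then 0 else ∑ β ∈ cofaces X (insert x σ), h x β := by
  have : ∑ β ∈ cofaces X σ, ∑ x ∈ β \ σ, h x β =
      ∑ x ∈ Finset.univ.filter (· ∉ σ), ∑ β ∈ cofaces X (insert x σ), h x β := by
    refine Finset.sum_comm' fun β x => ?_
    simp only [mem_cofaces, Finset.mem_sdiff, Finset.mem_filter, Finset.mem_univ, true_and,
      Finset.insert_subset_iff]
    tauto
  rw [this, Finset.sum_filter]
  exact Finset.sum_congr rfl fun x _ => by by_cases hx : x ∈ σ <;> simp [hx]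

/-- Each `β ⊇ σ` is counted once for every one of its `k - |σ|` elements outside `σ`. -/
theorem sum_sum_cofaces_insert (hX : ∀ β ∈ X, β.card = k) (σ : Finset E) (F : Finset E → ℝ) :
    ∑ x, (if x ∈ σ then 0 else ∑ β ∈ cofaces X (insert x σ), F β) =
      ((k : ℝ) - σ.card) * ∑ β ∈ cofaces X σ, F β := by
  rw [← sum_cofaces_sum_sdiff X σ fun _ β => F β, Finset.mul_sum]
  refine Finset.sum_congr rfl fun β hβ => ?_
  rw [mem_cofaces] at hβ
  rw [Finset.sum_const, nsmul_eq_mul, Finset.cast_card_sdiff hβ.2, hX β hβ.1]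

theorem sum_linkWeight (hX : ∀ β ∈ X, β.card = k) (σ : Finset E) :
    ∑ x, linkWeight X σ x = ((k : ℝ) - σ.card) * (cofaces X σ).card := by
  have := sum_sum_cofaces_insert hX σ fun _ => 1
  simpa [linkWeight] using this

theorem sum_pairWeight (hX : ∀ β ∈ X, β.card = k) (σ : Finset E) (x : E) :
    ∑ y, pairWeight X σ x y = ((k : ℝ) - σ.card - 1) * linkWeight X σ x := by
  by_cases hx : x ∈ σ
  · simp [pairWeight_of_mem hx, linkWeight_of_mem hx]
  · simp only [pairWeight_of_notMem hx, sum_linkWeight hX, Finset.card_insert_of_notMem hx,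
      linkWeight_of_notMem hx]
    push_cast
    ring

/-- The edge weights of the link of `σ` are recovered by averaging those of the links of `σ + x`.
This is what lets local bounds be summed in the trickling-down step. -/
theorem sum_pairWeight_insert (hX : ∀ β ∈ X, β.card = k) (σ : Finset E) (y z : E) :
    ∑ x, (if x ∈ σ then 0 else pairWeight X (insert x σ) y z) =
      ((k : ℝ) - σ.card - 2) * pairWeight X σ y z := by
  have : ∀ x, (if x ∈ σ then 0 else pairWeight X (insert x σ) y z) =
      if y ∈ σ ∨ z ∈ σ ∨ y = z then 0 else linkWeight X (insert y (insert z σ)) x := by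
    intro x
    rw [pairWeight_eq]
    unfold linkWeight
    have e : insert y (insert z (insert x σ)) = insert x (insert y (insert z σ)) := by
      rw [Finset.insert_comm z x, Finset.insert_comm y x]
    rw [e]
    simp only [Finset.mem_insert]
    grind
  rw [Finset.sum_congr rfl fun x _ => this x, pairWeight_eq]
  split_ifs with h
  · simp
  · push Not at h
    rw [sum_linkWeight hX, Finset.card_insert_of_notMem (by simp [h.1, h.2.2]),
      Finset.card_insert_of_notMem h.2.1]
    push_cast
    ring

/-! ### Spectral bounds for links and trickling down. -/

/-- The second eigenvalue of the random walk on the weighted graph of the link of `σ` is at most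
`γ`; here `k` is the size of the members of `X`. -/
def LinkBound (X : Finset (Finset E)) (k : ℕ) (σ : Finset E) (γ : ℝ) : Prop :=
  ∀ g : E → ℝ, ∑ x, linkWeight X σ x * g x = 0 →
    ∑ x, ∑ y, pairWeight X σ x y * (g x * g y) ≤
      γ * (((k : ℝ) - σ.card - 1) * ∑ x, linkWeight X σ x * g x ^ 2)

/-- The bound for a link, without centering the function. -/
theorem LinkBound.sum_le (hX : ∀ β ∈ X, β.card = k) {γ : ℝ} (h : LinkBound X k σ γ)
    (hk : σ.card + 2 ≤ k) (hN : (cofaces X σ).Nonempty) (g : E → ℝ) :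
    ∑ x, ∑ y, pairWeight X σ x y * (g x * g y) ≤ ((k : ℝ) - σ.card - 1) *
      (γ * ∑ x, linkWeight X σ x * g x ^ 2 + (1 - γ) *
        ((∑ x, linkWeight X σ x * g x) ^ 2 / (((k : ℝ) - σ.card) * (cofaces X σ).card))) := by
  have hN' : 0 < ((cofaces X σ).card : ℝ) := by exact_mod_cast hN.card_pos
  have hk' : (σ.card : ℝ) + 2 ≤ k := by exact_mod_cast hk
  -- `p` is the total vertex weight and `c` below the weighted mean of `g`; the hypothesis is
  -- applied to `g - c`.
  set p := ((k : ℝ) - σ.card) * (cofaces X σ).card with hp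
  have hp0 : 0 < p := mul_pos (by linarith) hN'
  set A := ∑ x, linkWeight X σ x * g x with hA
  set c := A / p with hc
  have hcp : c * p = A := by rw [hc]; field_simp
  have hsum := sum_linkWeight hX σ
  rw [← hp] at hsum
  have h0 := h (fun x => g x - c) (by
    simp only [mul_sub, Finset.sum_sub_distrib, ← Finset.sum_mul, hsum]
    rw [← hA, ← hcp]
    ring)
  have e1 : ∑ x, linkWeight X σ x * (g x - c) ^ 2 =
      ∑ x, linkWeight X σ x * g x ^ 2 - A ^ 2 / p := by
    have : ∀ x, linkWeight X σ x * (g x - c) ^ 2 = linkWeight X σ x * g x ^ 2 -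
        2 * c * (linkWeight X σ x * g x) + c ^ 2 * linkWeight X σ x := fun x => by ring
    simp only [this, Finset.sum_add_distrib, Finset.sum_sub_distrib, ← Finset.mul_sum, hsum]
    rw [← hA, hc]
    field_simp
    ring
  have e2 : ∑ x, ∑ y, pairWeight X σ x y * ((g x - c) * (g y - c)) =
      ∑ x, ∑ y, pairWeight X σ x y * (g x * g y) - ((k : ℝ) - σ.card - 1) * (A ^ 2 / p) := by
    have h1 : ∑ x, ∑ y, pairWeight X σ x y * g x = ((k : ℝ) - σ.card - 1) * A := by
      rw [hA, Finset.mul_sum]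
      exact Finset.sum_congr rfl fun x _ => by rw [← Finset.sum_mul, sum_pairWeight hX]; ring
    have h2 : ∑ x, ∑ y, pairWeight X σ x y * g y = ((k : ℝ) - σ.card - 1) * A := by
      rw [Finset.sum_comm, ← h1]
      exact Finset.sum_congr rfl fun x _ => Finset.sum_congr rfl fun y _ => by
        rw [pairWeight_comm]
    have h3 : ∑ x, ∑ y, pairWeight X σ x y = ((k : ℝ) - σ.card - 1) * p := by
      rw [← hsum, Finset.mul_sum]
      exact Finset.sum_congr rfl fun x _ => sum_pairWeight hX σ x
    have : ∀ x y, pairWeight X σ x y * ((g x - c) * (g y - c)) =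
        pairWeight X σ x y * (g x * g y) - c * (pairWeight X σ x y * g x) -
          c * (pairWeight X σ x y * g y) + c ^ 2 * pairWeight X σ x y := fun x y => by ring
    simp only [this, Finset.sum_add_distrib, Finset.sum_sub_distrib, ← Finset.mul_sum, h1, h2, h3]
    rw [hc]
    field_simp
    ring
  rw [e1, e2] at h0
  linarith

/-- The trickling-down theorem for links. -/
theorem LinkBound.trickle (hX : ∀ β ∈ X, β.card = k) {γ : ℝ} (hγ0 : 0 ≤ γ) (hγ1 : γ < 1)
    (hk : σ.card + 3 ≤ k)
    (hconn : ∀ g : E → ℝ, (∀ x y, pairWeight X σ x y ≠ 0 → g x = g y) →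
      ∃ c, ∀ x, linkWeight X σ x ≠ 0 → g x = c)
    (h : ∀ x ∉ σ, LinkBound X k (insert x σ) γ) :
    LinkBound X k σ (γ / (1 - γ)) := by
  have hk' : (σ.card : ℝ) + 3 ≤ k := by exact_mod_cast hk
  set a := (k : ℝ) - σ.card - 1 with ha
  have ha0 : 0 < a := by linarith
  intro g hg
  have hrhs : a * ∑ x, linkWeight X σ x * g x ^ 2 = ∑ x, a * linkWeight X σ x * g x ^ 2 := by
    simp only [Finset.mul_sum, mul_assoc]
  rw [hrhs]
  refine sum_weight_mul_le_of_trickle (d := fun x => a * linkWeight X σ x) pairWeight_comm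
    pairWeight_nonneg (sum_pairWeight hX σ) ?_ hγ0 hγ1 ?_ ?_
  · intro g hg
    obtain ⟨c, hc⟩ := hconn g hg
    exact ⟨c, fun x hx => hc x (right_ne_zero_of_mul hx)⟩
  · intro g
    have hb : (0 : ℝ) < (k : ℝ) - σ.card - 2 := by linarith
    refine le_of_mul_le_mul_left ?_ hb
    -- The vertex weights of the link of `σ + x` are the edge weights at `x` in the link of `σ`.
    -- Hence the mean of `g` there is its average over the neighbours of `x`, and summing over `x`
    -- gives the quadratic inequality.
    have hloc : ∀ x, ∑ y, ∑ z, (if x ∈ σ then 0 else pairWeight X (insert x σ) y z) * (g y * g z) ≤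
        ((k : ℝ) - σ.card - 2) * (γ * ∑ y, pairWeight X σ x y * g y ^ 2 + (1 - γ) *
          ((∑ y, pairWeight X σ x y * g y) ^ 2 / (a * linkWeight X σ x))) := by
      intro x
      by_cases hx : x ∈ σ
      · simp [hx, pairWeight_of_mem hx]
      · simp only [hx, if_false, pairWeight_of_notMem hx, linkWeight_of_notMem hx]
        have hcard := Finset.card_insert_of_notMem hx
        rcases (cofaces X (insert x σ)).eq_empty_or_nonempty with hN | hN
        · have h1 : ∀ y, linkWeight X (insert x σ) y = 0 := by
            have h2 := sum_linkWeight hX (insert x σ)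
            rw [hN, Finset.card_empty, Nat.cast_zero, mul_zero,
              Finset.sum_eq_zero_iff_of_nonneg fun y _ => linkWeight_nonneg y] at h2
            exact fun y => h2 y (Finset.mem_univ y)
          have h3 : ∀ y z, pairWeight X (insert x σ) y z = 0 := by
            intro y z
            have h2 := sum_pairWeight hX (insert x σ) y
            rw [h1, mul_zero,
              Finset.sum_eq_zero_iff_of_nonneg fun z _ => pairWeight_nonneg y z] at h2
            exact h2 z (Finset.mem_univ z)
          simp [h1, h3]
        · have := (h x hx).sum_le hX (by omega) hN g
          rw [hcard] at this
          push_cast at this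
          have e1 : (k : ℝ) - (σ.card + 1) - 1 = (k : ℝ) - σ.card - 2 := by ring
          have e2 : (k : ℝ) - (σ.card + 1) = a := by rw [ha]; ring
          rwa [e1, e2] at this
    have hsum := Finset.sum_le_sum fun x (_ : x ∈ Finset.univ) => hloc x
    have e1 : ∑ x, ∑ y, ∑ z, (if x ∈ σ then 0 else pairWeight X (insert x σ) y z) * (g y * g z) =
        ((k : ℝ) - σ.card - 2) * ∑ x, ∑ y, pairWeight X σ x y * (g x * g y) := by
      rw [Finset.sum_comm, Finset.mul_sum]
      refine Finset.sum_congr rfl fun y _ => ?_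
      rw [Finset.sum_comm, Finset.mul_sum]
      refine Finset.sum_congr rfl fun z _ => ?_
      rw [← Finset.sum_mul, sum_pairWeight_insert hX, mul_assoc]
    have e2 : ∑ x, ∑ y, pairWeight X σ x y * g y ^ 2 = ∑ x, a * linkWeight X σ x * g x ^ 2 := by
      rw [Finset.sum_comm]
      refine Finset.sum_congr rfl fun y _ => ?_
      rw [← sum_pairWeight hX, Finset.sum_mul]
      exact Finset.sum_congr rfl fun x _ => by rw [pairWeight_comm]
    rw [e1, ← Finset.mul_sum, Finset.sum_add_distrib, ← Finset.mul_sum, ← Finset.mul_sum, e2]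
      at hsum
    exact hsum
  · simp only [mul_assoc, ← Finset.mul_sum, hg, mul_zero]

/-! ### Decay of variance, from links to the whole family. -/

/-- A spectral bound for the link of `σ` makes the variance of `f` decay in at most a controlled
way when a random vertex of the link is added to `σ`. -/
theorem LinkBound.mul_cofaceVariance_le (hX : ∀ β ∈ X, β.card = k) {γ : ℝ} (hγ0 : 0 ≤ γ)
    (h : LinkBound X k σ γ) (hk : σ.card + 2 ≤ k) (f : Finset E → ℝ) :
    ((k : ℝ) - σ.card - 1) * (1 - γ) * cofaceVariance X f σ ≤
      ∑ x, if x ∈ σ then 0 else cofaceVariance X f (insert x σ) := by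
  have hk' : (σ.card : ℝ) + 2 ≤ k := by exact_mod_cast hk
  wlog hS : ∑ β ∈ cofaces X σ, f β = 0 generalizing f with H
  · have hN : (cofaces X σ).Nonempty := by
      by_contra hN
      rw [Finset.not_nonempty_iff_eq_empty] at hN
      simp [hN] at hS
    have hN' : ((cofaces X σ).card : ℝ) ≠ 0 := by exact_mod_cast hN.card_pos.ne'
    have := H (fun β => f β - (∑ β ∈ cofaces X σ, f β) / (cofaces X σ).card) (by
      rw [Finset.sum_sub_distrib, Finset.sum_const, nsmul_eq_mul]
      field_simp
      ring)
    simpa only [cofaceVariance_sub_const] using this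
  -- `g x` is the conditional mean of `f` given `x ∈ β`, and `A` below is the squared weighted norm
  -- of `g`. The claim reduces to `A ≤ (1 + γ(k - |σ| - 1)) V`.
  set S : E → ℝ := fun x => ∑ β ∈ cofaces X (insert x σ), f β with hSdef
  set g : E → ℝ := fun x => S x / (cofaces X (insert x σ)).card with hg
  have hNg : ∀ x, (cofaces X (insert x σ)).card * g x = S x := by
    intro x
    rcases (cofaces X (insert x σ)).eq_empty_or_nonempty with hN | hN
    · simp [hSdef, hN]
    · have hN' : ((cofaces X (insert x σ)).card : ℝ) ≠ 0 := by exact_mod_cast hN.card_pos.ne'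
      simp only [hg]
      field_simp
  have hwS : ∀ x, linkWeight X σ x * g x = if x ∈ σ then 0 else S x := by
    intro x
    by_cases hx : x ∈ σ
    · simp [hx, linkWeight_of_mem hx]
    · rw [linkWeight_of_notMem hx, hNg, if_neg hx]
  have hmean : ∑ x, linkWeight X σ x * g x = 0 := by
    simp only [hwS, hSdef]
    rw [sum_sum_cofaces_insert hX, hS, mul_zero]
  set A := ∑ x, linkWeight X σ x * g x ^ 2 with hA
  have hA0 : 0 ≤ A := Finset.sum_nonneg fun x _ => mul_nonneg (linkWeight_nonneg x) (sq_nonneg _)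
  have hV : cofaceVariance X f σ = ∑ β ∈ cofaces X σ, f β ^ 2 := by
    simp [cofaceVariance, hS]
  set V := ∑ β ∈ cofaces X σ, f β ^ 2 with hVdef
  have hsum : ∑ x, (if x ∈ σ then 0 else cofaceVariance X f (insert x σ)) =
      ((k : ℝ) - σ.card) * V - A := by
    rw [hVdef, ← sum_sum_cofaces_insert hX, hA, ← Finset.sum_sub_distrib]
    refine Finset.sum_congr rfl fun x _ => ?_
    by_cases hx : x ∈ σ
    · simp [hx, linkWeight_of_mem hx]
    · simp only [hx, if_false, linkWeight_of_notMem hx, cofaceVariance]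
      rw [sub_right_inj, pow_two (g x), ← mul_assoc, hNg]
      simp only [hg, hSdef]
      ring
  -- `G` lifts `g` back to the members of the family by the adjoint of averaging, so its inner
  -- product with `f` is `A`. Its squared norm splits into a diagonal part `A` and the edge form
  -- bounded by `LinkBound`; Cauchy–Schwarz then bounds `A`.
  set G : Finset E → ℝ := fun β => ∑ x ∈ β \ σ, g x with hG
  have hfG : ∑ β ∈ cofaces X σ, f β * G β = A := by
    simp only [hG, Finset.mul_sum]
    rw [sum_cofaces_sum_sdiff X σ fun x β => f β * g x, hA]
    refine Finset.sum_congr rfl fun x _ => ?_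
    rw [pow_two, ← mul_assoc, hwS, ← Finset.sum_mul]
    split_ifs <;> simp [hSdef]
  have hGG : ∑ β ∈ cofaces X σ, G β ^ 2 ≤ (1 + γ * ((k : ℝ) - σ.card - 1)) * A := by
    have e : ∑ β ∈ cofaces X σ, G β ^ 2 =
        A + ∑ x, ∑ y, pairWeight X σ x y * (g x * g y) := by
      have : ∀ β, G β ^ 2 = ∑ x ∈ β \ σ, g x * G β := fun β => by
        rw [pow_two, ← Finset.sum_mul]
      simp only [this]
      rw [sum_cofaces_sum_sdiff X σ fun x β => g x * G β, hA, ← Finset.sum_add_distrib]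
      refine Finset.sum_congr rfl fun x _ => ?_
      by_cases hx : x ∈ σ
      · simp [hx, linkWeight_of_mem hx, pairWeight_of_mem hx]
      · simp only [hx, if_false, pairWeight_of_notMem hx]
        have h1 : ∀ β ∈ cofaces X (insert x σ),
            g x * G β = g x ^ 2 + ∑ y ∈ β \ insert x σ, g x * g y := by
          intro β hβ
          have hxβ : x ∈ β := (mem_cofaces.1 hβ).2 (Finset.mem_insert_self x σ)
          have h2 : β \ σ = insert x (β \ insert x σ) := by
            ext y
            simp only [Finset.mem_sdiff, Finset.mem_insert]
            by_cases hyx : y = x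
            · subst hyx; simp [hxβ, hx]
            · simp [hyx]
          simp only [hG]
          rw [h2, Finset.sum_insert (by simp), ← Finset.mul_sum]
          ring
        rw [Finset.sum_congr rfl h1, Finset.sum_add_distrib,
          sum_cofaces_sum_sdiff X (insert x σ) fun y β => g x * g y, linkWeight_of_notMem hx]
        simp only [Finset.sum_const, nsmul_eq_mul]
        congr 1
        refine Finset.sum_congr rfl fun y _ => ?_
        unfold linkWeight
        split_ifs <;> simp
    rw [e]
    have := h g hmean
    rw [← hA] at this
    linarith
  set c := 1 + γ * ((k : ℝ) - σ.card - 1) with hc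
  have hc0 : 0 < c := by
    have : 0 ≤ γ * ((k : ℝ) - σ.card - 1) := mul_nonneg hγ0 (by linarith)
    linarith
  have hV0 : 0 ≤ V := Finset.sum_nonneg fun β _ => sq_nonneg _
  have hAV : A ≤ c * V := by
    have hcs := Finset.sum_mul_sq_le_sq_mul_sq (cofaces X σ) f G
    rw [hfG, ← hVdef] at hcs
    have h1 : A ^ 2 ≤ V * (c * A) := hcs.trans (mul_le_mul_of_nonneg_left hGG hV0)
    rcases hA0.eq_or_lt with h0 | h0
    · rw [← h0]; positivity
    · nlinarith
  rw [hsum, hV]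
  have : ((k : ℝ) - σ.card - 1) * (1 - γ) * V = ((k : ℝ) - σ.card) * V - c * V := by
    rw [hc]; ring
  linarith

/-- Local-to-global: spectral bounds for all links bound the variance of `f` by the sum of its
local variances over the sets of size one less. -/
theorem cofaceVariance_le_sum (hX : ∀ β ∈ X, β.card = k) (f : Finset E → ℝ)
    (h : ∀ σ : Finset E, σ.card + 2 ≤ k → LinkBound X k σ (1 / ((σ.card : ℝ) + 4))) :
    ∀ (n : ℕ) (σ : Finset E), σ.card + n + 1 = k →
      cofaceVariance X f σ ≤ ((k : ℝ) + 2) / (σ.card + 3) *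
        ∑ τ ∈ cofaces (Finset.univ.powersetCard (k - 1)) σ, cofaceVariance X f τ := by
  have hY : ∀ τ ∈ (Finset.univ : Finset E).powersetCard (k - 1), τ.card = k - 1 := fun τ hτ =>
    (Finset.mem_powersetCard.1 hτ).2
  intro n
  induction n with
  | zero =>
    intro σ hσ
    have h1 : cofaces (Finset.univ.powersetCard (k - 1)) σ = {σ} := by
      ext τ
      simp only [mem_cofaces, Finset.mem_powersetCard, Finset.subset_univ, true_and,
        Finset.mem_singleton]
      constructor
      · rintro ⟨h1, h2⟩
        exact (Finset.eq_of_subset_of_card_le h2 (by omega)).symm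
      · rintro rfl
        exact ⟨by omega, subset_rfl⟩
    rw [h1, Finset.sum_singleton]
    have h2 : (k : ℝ) = σ.card + 1 := by rw [← hσ]; push_cast; ring
    rw [h2]
    have h3 : ((σ.card : ℝ) + 1 + 2) / (σ.card + 3) = 1 := by
      rw [div_eq_one_iff_eq (by positivity)]
      ring
    rw [h3, one_mul]
  | succ n ih =>
    intro σ hσ
    have hk : (k : ℝ) = σ.card + n + 2 := by rw [← hσ]; push_cast; ring
    have hγ : 0 ≤ 1 / ((σ.card : ℝ) + 4) := by positivity
    have h1 := (h σ (by omega)).mul_cofaceVariance_le hX hγ (by omega) f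
    have h2 : ∑ x, (if x ∈ σ then 0 else cofaceVariance X f (insert x σ)) ≤
        ∑ x, ((k : ℝ) + 2) / (σ.card + 4) * (if x ∈ σ then 0 else
          ∑ τ ∈ cofaces (Finset.univ.powersetCard (k - 1)) (insert x σ), cofaceVariance X f τ) := by
      refine Finset.sum_le_sum fun x _ => ?_
      by_cases hx : x ∈ σ
      · simp [hx]
      · simp only [hx, if_false]
        have hc := Finset.card_insert_of_notMem hx
        have := ih (insert x σ) (by omega)
        rw [hc] at this
        push_cast at this
        rwa [show (σ.card : ℝ) + 1 + 3 = σ.card + 4 by ring] at this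
    rw [← Finset.mul_sum, sum_sum_cofaces_insert hY] at h2
    have hk1 : ((k - 1 : ℕ) : ℝ) = (k : ℝ) - 1 := by rw [Nat.cast_sub (by omega)]; simp
    rw [hk1] at h2
    set D := ∑ τ ∈ cofaces (Finset.univ.powersetCard (k - 1)) σ, cofaceVariance X f τ
    have h3 := h1.trans h2
    have hs : (0 : ℝ) ≤ σ.card := by positivity
    have hn : (0 : ℝ) ≤ n := by positivity
    -- Here `n + 1 = k - 1 - |σ|` is both the factor in the variance bound and the number of times
    -- each `τ` is counted, so it cancels. What remains is the telescoping factor `(|σ| + 3)/(|σ| +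
    -- 4)`.
    have e1 : ((k : ℝ) - σ.card - 1) * (1 - 1 / ((σ.card : ℝ) + 4)) * cofaceVariance X f σ =
        ((n : ℝ) + 1) / (σ.card + 4) * ((σ.card + 3) * cofaceVariance X f σ) := by
      rw [hk]
      field_simp
      ring
    have e2 : ((k : ℝ) + 2) / (σ.card + 4) * (((k : ℝ) - 1 - σ.card) * D) =
        ((n : ℝ) + 1) / (σ.card + 4) * ((k + 2) * D) := by
      rw [show (k : ℝ) - 1 - σ.card = n + 1 by rw [hk]; ring]
      field_simp
    rw [e1, e2] at h3
    have h4 := le_of_mul_le_mul_left h3 (by positivity)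
    rw [div_mul_eq_mul_div, le_div_iff₀ (by positivity)]
    linarith

end UniformFamily

/-! ### Blocked and parallel elements in one partition matroid. -/

/-- The indicator of an equivalence relation, given by a labelling, is positive semidefinite. -/
theorem sum_sum_ite_eq_mul_nonneg {ι κ : Type*} [DecidableEq κ] (V : Finset ι) (l : ι → κ)
    (h : ι → ℝ) : 0 ≤ ∑ x ∈ V, ∑ y ∈ V, if l x = l y then h x * h y else 0 := by
  have : ∑ x ∈ V, ∑ y ∈ V, (if l x = l y then h x * h y else 0) =
      ∑ c ∈ V.image l, (∑ x ∈ V, if l x = c then h x else 0) ^ 2 := by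
    simp only [pow_two, Finset.sum_mul_sum]
    rw [Finset.sum_comm' (t' := V) (s' := fun _ => V.image l) (by tauto)]
    refine Finset.sum_congr rfl fun x hx => ?_
    rw [Finset.sum_comm]
    refine Finset.sum_congr rfl fun y _ => ?_
    rw [Finset.sum_eq_single (l x)]
    · simp [eq_comm]
    · intro c _ hc
      simp [Ne.symm hc]
    · intro h'
      exact absurd (Finset.mem_image_of_mem l hx) h'
  rw [this]
  exact Finset.sum_nonneg fun c _ => sq_nonneg _

namespace PartitionMatroid

variable {E : Type*} [Fintype E] [DecidableEq E]

open scoped Classical in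
/-- An independent set meets the span of `τ` in at most `|τ|` elements. -/
theorem card_filter_blocked_le (P : PartitionMatroid E) {T τ : Finset E} (hT : P.IsIndep T)
    (hτ : P.IsIndep τ) :
    (T.filter fun t => t ∈ τ ∨ ¬ P.IsIndep (insert t τ)).card ≤ τ.card := by
  by_contra! hlt
  obtain ⟨e, he, heτ, hi⟩ := P.isIndep_augment hτ
    (P.isIndep_subset hT (Finset.filter_subset _ _)) hlt
  have := (Finset.mem_filter.1 he).2
  tauto

/-- Being parallel over `σ` is transitive. -/
theorem not_isIndep_insert_insert_trans (P : PartitionMatroid E) {σ : Finset E} {x y z : E}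
    (hx : x ∉ σ) (hy : y ∉ σ) (hz : z ∉ σ) (hyi : P.IsIndep (insert y σ)) (hxz : x ≠ z)
    (hxy : x = y ∨ ¬ P.IsIndep (insert x (insert y σ)))
    (hyz : z = y ∨ ¬ P.IsIndep (insert z (insert y σ))) :
    ¬ P.IsIndep (insert x (insert z σ)) := by
  intro hi
  have hcard : (insert y σ).card < (insert x (insert z σ)).card := by
    rw [Finset.card_insert_of_notMem hy, Finset.card_insert_of_notMem (by simp [hx, hxz]),
      Finset.card_insert_of_notMem hz]
    omega
  obtain ⟨e, he, hey, hei⟩ := P.isIndep_augment hyi hi hcard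
  simp only [Finset.mem_insert, not_or] at he hey
  rcases he with rfl | rfl | he
  · exact hxy.elim hey.1 fun h => h hei
  · exact hyz.elim hey.1 fun h => h hei
  · exact hey.2 he

open scoped Classical in
/-- An independent set meets the union of the spans of `σ + x` and `σ + y` in at most `|σ| + 2`
elements. -/
theorem card_filter_blocked_pair_le (P : PartitionMatroid E) {T σ : Finset E} {x y : E}
    (hT : P.IsIndep T) (hx : x ∉ σ) (hy : y ∉ σ) (hxi : P.IsIndep (insert x σ))
    (hyi : P.IsIndep (insert y σ)) :
    (T.filter fun t => (t ∈ insert x σ ∨ ¬ P.IsIndep (insert t (insert x σ))) ∨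
      (t ∈ insert y σ ∨ ¬ P.IsIndep (insert t (insert y σ)))).card ≤ σ.card + 2 := by
  by_cases hxy : P.IsIndep (insert x (insert y σ))
  · have h1 := P.card_filter_blocked_le hT hxy
    have h2 : (insert x (insert y σ)).card ≤ σ.card + 2 :=
      (Finset.card_insert_le _ _).trans (Nat.add_le_add_right (Finset.card_insert_le _ _) 1)
    refine (Finset.card_le_card ?_).trans (h1.trans h2)
    intro t ht
    rw [Finset.mem_filter] at ht ⊢
    refine ⟨ht.1, ?_⟩
    rcases ht.2 with (h | h) | (h | h)
    · left; simp only [Finset.mem_insert] at h ⊢; tauto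
    · right
      exact fun h' => h (P.isIndep_subset h'
        (Finset.insert_subset_insert t (Finset.insert_subset_insert x (Finset.subset_insert y σ))))
    · left; simp only [Finset.mem_insert] at h ⊢; tauto
    · right
      exact fun h' => h (P.isIndep_subset h'
        (Finset.insert_subset_insert t (Finset.subset_insert x _)))
  -- Now `x` and `y` are parallel. If the blocked set were too large, augmenting `σ + x` from it
  -- would give an element blocked over `σ + y`, hence parallel to `y` and so to `x`, a
  -- contradiction.
  · by_contra! hlt
    have hlt' := (Finset.card_insert_of_notMem hx).trans_lt (Nat.lt_of_succ_lt hlt)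
    obtain ⟨e, he, hex, hei⟩ := P.isIndep_augment hxi
      (P.isIndep_subset hT (Finset.filter_subset _ _)) hlt'
    have he2 := (Finset.mem_filter.1 he).2
    have hex' := hex
    simp only [Finset.mem_insert, not_or] at hex'
    have hy2 : e = y ∨ ¬ P.IsIndep (insert e (insert y σ)) := by
      rcases he2 with h | h | h
      · tauto
      · rw [Finset.mem_insert] at h
        tauto
      · exact Or.inr h
    exact P.not_isIndep_insert_insert_trans hex'.2 hy hx hyi hex'.1 hy2 (Or.inr hxy) hei

/-- Two elements that are parallel over an independent set lie in the same block. -/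
theorem sameBlock_of_not_isIndep (P : PartitionMatroid E) {σ : Finset E} {x y : E}
    (hx : P.IsIndep (insert x σ)) (hy : P.IsIndep (insert y σ))
    (h : ¬ P.IsIndep (insert x (insert y σ))) : P.SameBlock x y := by
  unfold IsIndep at h
  push Not at h
  obtain ⟨B, hB, hlt⟩ := h
  refine ⟨B, hB, ?_, ?_⟩
  · by_contra hxB
    rw [Finset.insert_inter_of_notMem hxB] at hlt
    exact absurd (hy B hB) (not_le.2 hlt)
  · by_contra hyB
    rw [Finset.insert_comm, Finset.insert_inter_of_notMem hyB] at hlt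
    exact absurd (hx B hB) (not_le.2 hlt)

open scoped Classical in
/-- The quadratic form of the relation of being parallel over `σ` is positive semidefinite. -/
theorem sum_parallel_nonneg (P : PartitionMatroid E) {σ : Finset E} {V : Finset E}
    (hV : ∀ x ∈ V, x ∉ σ ∧ P.IsIndep (insert x σ)) (h : E → ℝ) :
    0 ≤ ∑ x ∈ V, ∑ y ∈ V,
      if x = y ∨ ¬ P.IsIndep (insert x (insert y σ)) then h x * h y else 0 := by
  -- Each vertex is labelled by its own parallel class.
  set l : E → Finset E := fun x =>
    V.filter fun y => x = y ∨ ¬ P.IsIndep (insert x (insert y σ)) with hl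
  have hsymm : ∀ x y, (x = y ∨ ¬ P.IsIndep (insert x (insert y σ))) →
      (y = x ∨ ¬ P.IsIndep (insert y (insert x σ))) := by
    intro x y hxy
    rwa [Finset.insert_comm, eq_comm]
  have htrans : ∀ x ∈ V, ∀ y ∈ V, ∀ z ∈ V, (x = y ∨ ¬ P.IsIndep (insert x (insert y σ))) →
      (y = z ∨ ¬ P.IsIndep (insert y (insert z σ))) →
      (x = z ∨ ¬ P.IsIndep (insert x (insert z σ))) := by
    intro x hx y hy z hz hxy hyz
    by_cases hxz : x = z
    · exact Or.inl hxz
    · exact Or.inr (P.not_isIndep_insert_insert_trans (hV x hx).1 (hV y hy).1 (hV z hz).1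
        (hV y hy).2 hxz hxy (hsymm _ _ hyz))
  have key : ∀ x ∈ V, ∀ y ∈ V, (x = y ∨ ¬ P.IsIndep (insert x (insert y σ))) ↔ l x = l y := by
    intro x hx y hy
    constructor
    · intro hxy
      simp only [hl]
      refine Finset.filter_congr fun z hz => ⟨fun hxz => ?_, fun hyz => ?_⟩
      · exact htrans y hy x hx z hz (hsymm _ _ hxy) hxz
      · exact htrans x hx y hy z hz hxy hyz
    · intro he
      have : y ∈ l x := by rw [he]; simp [hl, hy]
      exact (Finset.mem_filter.1 this).2
  refine (sum_sum_ite_eq_mul_nonneg V l h).trans_eq ?_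
  refine Finset.sum_congr rfl fun x hx => Finset.sum_congr rfl fun y hy => ?_
  simp only [key x hx y hy]

end PartitionMatroid

/-! ### Links in the complex of common independent sets. -/

section CommonIndependentSets

variable {E : Type*} [Fintype E] [DecidableEq E]

/-- The set `σ` is independent in both matroids. -/
def CommonIndep (P₁ P₂ : PartitionMatroid E) (σ : Finset E) : Prop :=
  P₁.IsIndep σ ∧ P₂.IsIndep σ

open scoped Classical in
/-- The family of common independent sets of size `k`. -/
noncomputable def commonIndepSets (P₁ P₂ : PartitionMatroid E) (k : ℕ) : Finset (Finset E) :=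
  Finset.univ.filter fun σ => CommonIndep P₁ P₂ σ ∧ σ.card = k

variable {P₁ P₂ : PartitionMatroid E} {k : ℕ} {T σ τ : Finset E}

theorem mem_commonIndepSets : σ ∈ commonIndepSets P₁ P₂ k ↔ CommonIndep P₁ P₂ σ ∧ σ.card = k := by
  simp [commonIndepSets]

theorem card_of_mem_commonIndepSets : ∀ β ∈ commonIndepSets P₁ P₂ k, β.card = k :=
  fun _ h => (mem_commonIndepSets.1 h).2

theorem CommonIndep.subset (h : CommonIndep P₁ P₂ τ) (hs : σ ⊆ τ) : CommonIndep P₁ P₂ σ :=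
  ⟨P₁.isIndep_subset h.1 hs, P₂.isIndep_subset h.2 hs⟩

-- Each of the two matroids blocks at most `|τ|` elements of `T`; every other element of `T` extends
-- `τ`. This count stands in for the exchange property, which common independent sets do not have.
open scoped Classical in
theorem CommonIndep.card_le_add_card_extensions (hT : CommonIndep P₁ P₂ T)
    (hτ : CommonIndep P₁ P₂ τ) :
    T.card ≤ 2 * τ.card + (T.filter fun t => t ∉ τ ∧ CommonIndep P₁ P₂ (insert t τ)).card := by
  have h1 := P₁.card_filter_blocked_le hT.1 hτ.1
  have h2 := P₂.card_filter_blocked_le hT.2 hτ.2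
  have hsub : T ⊆ ((T.filter fun t => t ∈ τ ∨ ¬ P₁.IsIndep (insert t τ)) ∪
      (T.filter fun t => t ∈ τ ∨ ¬ P₂.IsIndep (insert t τ))) ∪
      T.filter fun t => t ∉ τ ∧ CommonIndep P₁ P₂ (insert t τ) := by
    intro t ht
    have : CommonIndep P₁ P₂ (insert t τ) ↔ _ := Iff.rfl
    simp only [Finset.mem_union, Finset.mem_filter, ht, true_and]
    tauto
  have h3 := Finset.card_le_card hsub
  have h4 := Finset.card_union_le ((T.filter fun t => t ∈ τ ∨ ¬ P₁.IsIndep (insert t τ)) ∪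
      (T.filter fun t => t ∈ τ ∨ ¬ P₂.IsIndep (insert t τ)))
      (T.filter fun t => t ∉ τ ∧ CommonIndep P₁ P₂ (insert t τ))
  have h5 := Finset.card_union_le (T.filter fun t => t ∈ τ ∨ ¬ P₁.IsIndep (insert t τ))
      (T.filter fun t => t ∈ τ ∨ ¬ P₂.IsIndep (insert t τ))
  omega

/-- Purity of the complex: below size `k` the count of extensions is positive, so elements of `T`
can be added one at a time. -/
theorem CommonIndep.cofaces_nonempty (hT : CommonIndep P₁ P₂ T) (hk : 2 * k ≤ T.card) :
    ∀ (n : ℕ) (τ : Finset E), CommonIndep P₁ P₂ τ → τ.card + n = k →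
      (cofaces (commonIndepSets P₁ P₂ k) τ).Nonempty := by
  classical
  intro n
  induction n with
  | zero =>
    intro τ hτ hc
    exact ⟨τ, mem_cofaces.2 ⟨mem_commonIndepSets.2 ⟨hτ, by omega⟩, subset_rfl⟩⟩
  | succ n ih =>
    intro τ hτ hc
    have h1 := hT.card_le_add_card_extensions hτ
    obtain ⟨t, ht⟩ : (T.filter fun t => t ∉ τ ∧ CommonIndep P₁ P₂ (insert t τ)).Nonempty := by
      rw [← Finset.card_pos]
      omega
    obtain ⟨-, htτ, hti⟩ := Finset.mem_filter.1 ht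
    obtain ⟨β, hβ⟩ := ih (insert t τ) hti (by rw [Finset.card_insert_of_notMem htτ]; omega)
    rw [mem_cofaces] at hβ
    exact ⟨β, mem_cofaces.2 ⟨hβ.1, (Finset.subset_insert t τ).trans hβ.2⟩⟩

theorem CommonIndep.card_cofaces_ne_zero (hT : CommonIndep P₁ P₂ T) (hk : 2 * k ≤ T.card)
    (hτ : CommonIndep P₁ P₂ τ) (hc : τ.card ≤ k) :
    ((cofaces (commonIndepSets P₁ P₂ k) τ).card : ℝ) ≠ 0 := by
  have := (hT.cofaces_nonempty hk (k - τ.card) τ hτ (by omega)).card_pos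
  exact_mod_cast this.ne'

theorem commonIndep_of_cofaces_nonempty
    (h : (cofaces (commonIndepSets P₁ P₂ k) τ).Nonempty) : CommonIndep P₁ P₂ τ := by
  obtain ⟨β, hβ⟩ := h
  rw [mem_cofaces, mem_commonIndepSets] at hβ
  exact hβ.1.1.subset hβ.2

theorem commonIndep_of_linkWeight_ne_zero {x : E}
    (h : linkWeight (commonIndepSets P₁ P₂ k) σ x ≠ 0) :
    x ∉ σ ∧ CommonIndep P₁ P₂ (insert x σ) := by
  have hx : x ∉ σ := fun hx => h (linkWeight_of_mem hx)
  refine ⟨hx, commonIndep_of_cofaces_nonempty (k := k) ?_⟩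
  rw [linkWeight_of_notMem hx] at h
  rw [← Finset.card_pos, Nat.pos_iff_ne_zero]
  exact_mod_cast h

/-- Distinct extending elements of `T` give distinct members of the family. This is the minimum
degree bound for the graph links. -/
theorem CommonIndep.le_card_cofaces (hT : CommonIndep P₁ P₂ T) (hτ : CommonIndep P₁ P₂ τ)
    (hc : τ.card + 1 = k) :
    T.card ≤ 2 * τ.card + (cofaces (commonIndepSets P₁ P₂ k) τ).card := by
  classical
  refine (hT.card_le_add_card_extensions hτ).trans (Nat.add_le_add_left ?_ _)
  refine Finset.card_le_card_of_injOn (fun t => insert t τ) ?_ ?_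
  · intro t ht
    obtain ⟨-, htτ, hti⟩ := Finset.mem_filter.1 ht
    exact mem_cofaces.2 ⟨mem_commonIndepSets.2 ⟨hti, by
      rw [Finset.card_insert_of_notMem htτ, hc]⟩, Finset.subset_insert t τ⟩
  · intro s hs t ht hst
    have hs' := (Finset.mem_filter.1 hs).2.1
    have : s ∈ insert t τ := by
      rw [← show insert s τ = insert t τ from hst]
      exact Finset.mem_insert_self s τ
    exact (Finset.mem_insert.1 this).resolve_right hs'

/-- Any two vertices of a link have a common neighbour. -/
theorem CommonIndep.exists_common_neighbour (hT : CommonIndep P₁ P₂ T) {x y : E} (hx : x ∉ σ)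
    (hy : y ∉ σ) (hxi : CommonIndep P₁ P₂ (insert x σ)) (hyi : CommonIndep P₁ P₂ (insert y σ))
    (hc : 2 * (σ.card + 2) < T.card) :
    ∃ z, z ∉ insert x σ ∧ z ∉ insert y σ ∧ CommonIndep P₁ P₂ (insert z (insert x σ)) ∧
      CommonIndep P₁ P₂ (insert z (insert y σ)) := by
  classical
  have h1 := P₁.card_filter_blocked_pair_le hT.1 hx hy hxi.1 hyi.1
  have h2 := P₂.card_filter_blocked_pair_le hT.2 hx hy hxi.2 hyi.2
  -- Without a common neighbour, `T` would be covered by the two blocked sets, which have at most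
  -- `|σ| + 2` elements each.
  by_contra! hcon
  have hsub : T ⊆ (T.filter fun t => (t ∈ insert x σ ∨ ¬ P₁.IsIndep (insert t (insert x σ))) ∨
        (t ∈ insert y σ ∨ ¬ P₁.IsIndep (insert t (insert y σ)))) ∪
      (T.filter fun t => (t ∈ insert x σ ∨ ¬ P₂.IsIndep (insert t (insert x σ))) ∨
        (t ∈ insert y σ ∨ ¬ P₂.IsIndep (insert t (insert y σ)))) := by
    intro t ht
    have := hcon t
    simp only [CommonIndep] at this
    simp only [Finset.mem_union, Finset.mem_filter, ht, true_and]
    tauto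
  have h3 := (Finset.card_le_card hsub).trans (Finset.card_union_le _ _)
  omega

/-- The spectral bound for the links that are graphs: complements of line graphs. -/
theorem CommonIndep.linkBound_of_card_add_two (hT : CommonIndep P₁ P₂ T)
    (hblocks : ∀ x y : E, x ≠ y → ¬ (P₁.SameBlock x y ∧ P₂.SameBlock x y))
    (hk : 3 * k ≤ T.card) (hσ : σ.card + 2 = k) :
    LinkBound (commonIndepSets P₁ P₂ k) k σ (1 / ((σ.card : ℝ) + 4)) := by
  classical
  set X := commonIndepSets P₁ P₂ k with hXdef
  have hX : ∀ β ∈ X, β.card = k := card_of_mem_commonIndepSets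
  have hkσ : (k : ℝ) - σ.card - 1 = 1 := by rw [← hσ]; push_cast; ring
  intro g hg
  set V : Finset E := Finset.univ.filter fun x => x ∉ σ ∧ CommonIndep P₁ P₂ (insert x σ) with hV
  have hmemV : ∀ x, x ∈ V ↔ x ∉ σ ∧ CommonIndep P₁ P₂ (insert x σ) := fun x => by simp [hV]
  have hlink0 : ∀ x, x ∉ V → linkWeight X σ x = 0 := by
    intro x hx
    by_contra h
    exact hx ((hmemV x).2 (commonIndep_of_linkWeight_ne_zero h))
  have hpair0 : ∀ x y, x ∉ V → pairWeight X σ x y = 0 := by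
    intro x y hx
    have := sum_pairWeight hX σ x
    rw [hlink0 x hx, mul_zero, Finset.sum_eq_zero_iff_of_nonneg fun y _ => pairWeight_nonneg x y]
      at this
    exact this y (Finset.mem_univ y)
  -- The degree is at least `3k - 2(k - 1) = k + 2`.
  have hlink : ∀ x ∈ V, (σ.card : ℝ) + 4 ≤ linkWeight X σ x := by
    intro x hx
    obtain ⟨hxσ, hxi⟩ := (hmemV x).1 hx
    have hc := Finset.card_insert_of_notMem hxσ
    have := hT.le_card_cofaces hxi (k := k) (by omega)
    rw [← hXdef] at this
    rw [linkWeight_of_notMem hxσ]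
    exact_mod_cast (by omega : σ.card + 4 ≤ (cofaces X (insert x σ)).card)
  have hpair : ∀ x ∈ V, ∀ y ∈ V, x ≠ y → pairWeight X σ x y =
      if CommonIndep P₁ P₂ (insert x (insert y σ)) then 1 else 0 := by
    intro x hx y hy hxy
    have hxσ := ((hmemV x).1 hx).1
    have hyσ := ((hmemV y).1 hy).1
    rw [pairWeight_eq, if_neg (by tauto)]
    have hc : (insert x (insert y σ)).card = k := by
      rw [Finset.card_insert_of_notMem (by simp [hxσ, hxy]), Finset.card_insert_of_notMem hyσ, ← hσ]
    have hcof : cofaces X (insert x (insert y σ)) =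
        if CommonIndep P₁ P₂ (insert x (insert y σ)) then {insert x (insert y σ)} else ∅ := by
      ext β
      rw [mem_cofaces, hXdef, mem_commonIndepSets]
      constructor
      · rintro ⟨⟨h1, h2⟩, h3⟩
        have : insert x (insert y σ) = β := Finset.eq_of_subset_of_card_le h3 (by omega)
        rw [this, if_pos h1]
        simp
      · intro h
        split_ifs at h with hi
        · rw [Finset.mem_singleton] at h
          subst h
          exact ⟨⟨hi, hc⟩, subset_rfl⟩
        · simp at h
    rw [hcof]
    split_ifs <;> simp
  have hQ : ∀ h : E → ℝ, ∑ x, ∑ y, pairWeight X σ x y * (h x * h y) ≤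
      (∑ x ∈ V, h x) ^ 2 + ∑ x ∈ V, h x ^ 2 := by
    intro h
    have h0 : ∑ x, ∑ y, pairWeight X σ x y * (h x * h y) =
        ∑ x ∈ V, ∑ y ∈ V, pairWeight X σ x y * (h x * h y) := by
      symm
      rw [Finset.sum_subset (Finset.subset_univ V) fun x _ hx =>
        Finset.sum_eq_zero fun y _ => by rw [hpair0 x y hx, zero_mul]]
      refine Finset.sum_congr rfl fun x _ => ?_
      exact Finset.sum_subset (Finset.subset_univ V) fun y _ hy => by
        rw [pairWeight_comm, hpair0 y x hy, zero_mul]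
    have h1 := P₁.sum_parallel_nonneg (σ := σ) (V := V)
      (fun x hx => ⟨((hmemV x).1 hx).1, ((hmemV x).1 hx).2.1⟩) h
    have h2 := P₂.sum_parallel_nonneg (σ := σ) (V := V)
      (fun x hx => ⟨((hmemV x).1 hx).1, ((hmemV x).1 hx).2.2⟩) h
    have h3 : (∑ x ∈ V, h x) ^ 2 + ∑ x ∈ V, h x ^ 2 =
        ∑ x ∈ V, ∑ y ∈ V, (h x * h y + if x = y then h x * h y else 0) := by
      rw [pow_two, Finset.sum_mul_sum, ← Finset.sum_add_distrib]
      refine Finset.sum_congr rfl fun x hx => ?_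
      rw [Finset.sum_add_distrib, Finset.sum_ite_eq, if_pos hx, pow_two]
    -- The identity `J + I = A + R₁ + R₂`. On the diagonal both sides are `2`; off the diagonal
    -- exactly one term on the right is `1`, because `hblocks` excludes pairs parallel in both
    -- matroids.
    have h4 : ∑ x ∈ V, ∑ y ∈ V, (h x * h y + if x = y then h x * h y else 0) =
        ∑ x ∈ V, ∑ y ∈ V, pairWeight X σ x y * (h x * h y) +
        ∑ x ∈ V, ∑ y ∈ V, (if x = y ∨ ¬ P₁.IsIndep (insert x (insert y σ)) then h x * h y else 0) +
        ∑ x ∈ V, ∑ y ∈ V,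
          (if x = y ∨ ¬ P₂.IsIndep (insert x (insert y σ)) then h x * h y else 0) := by
      simp only [← Finset.sum_add_distrib]
      refine Finset.sum_congr rfl fun x hx => Finset.sum_congr rfl fun y hy => ?_
      by_cases hxy : x = y
      · subst hxy
        have : pairWeight X σ x x = 0 := by rw [pairWeight_eq, if_pos (by simp)]
        simp [this]
      · have hxi := ((hmemV x).1 hx).2
        have hyi := ((hmemV y).1 hy).2
        rw [hpair x hx y hy hxy]
        by_cases hi1 : P₁.IsIndep (insert x (insert y σ)) <;>
          by_cases hi2 : P₂.IsIndep (insert x (insert y σ))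
        · simp [CommonIndep, hi1, hi2, hxy]
        · simp [CommonIndep, hi1, hi2, hxy]
        · simp [CommonIndep, hi1, hi2, hxy]
        · exact absurd ⟨P₁.sameBlock_of_not_isIndep hxi.1 hyi.1 hi1,
            P₂.sameBlock_of_not_isIndep hxi.2 hyi.2 hi2⟩ (hblocks x y hxy)
    rw [h0, h3, h4]
    linarith
  have hrow : ∀ x, ∑ y, pairWeight X σ x y = linkWeight X σ x := by
    intro x
    rw [sum_pairWeight hX, hkσ, one_mul]
  -- `g` is centred for the degree weights, while removing the `J` term needs the unweighted mean
  -- `c` on `V`. Passing to `g - c` adds a non-negative term to the edge form and decreases the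
  -- norm, so both changes help.
  obtain ⟨c, hVc⟩ : ∃ c, ∑ x ∈ V, g x = V.card * c := by
    rcases V.eq_empty_or_nonempty with h | h
    · exact ⟨0, by simp [h]⟩
    · have : (V.card : ℝ) ≠ 0 := by exact_mod_cast h.card_pos.ne'
      exact ⟨(∑ x ∈ V, g x) / V.card, by field_simp⟩
  have hmean : ∑ x ∈ V, (g x - c) = 0 := by
    rw [Finset.sum_sub_distrib, hVc, Finset.sum_const, nsmul_eq_mul, sub_self]
  have hsq : ∑ x ∈ V, (g x - c) ^ 2 = ∑ x ∈ V, g x ^ 2 - V.card * c ^ 2 := by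
    have : ∀ x, (g x - c) ^ 2 = g x ^ 2 - 2 * c * g x + c ^ 2 := fun x => by ring
    simp only [this, Finset.sum_add_distrib, Finset.sum_sub_distrib, ← Finset.mul_sum, hVc,
      Finset.sum_const, nsmul_eq_mul]
    ring
  have hshift : ∑ x, ∑ y, pairWeight X σ x y * ((g x - c) * (g y - c)) =
      ∑ x, ∑ y, pairWeight X σ x y * (g x * g y) + c ^ 2 * ∑ x, linkWeight X σ x := by
    have h1 : ∑ x, ∑ y, pairWeight X σ x y * g x = 0 := by
      rw [← hg]
      exact Finset.sum_congr rfl fun x _ => by rw [← Finset.sum_mul, hrow]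
    have h2 : ∑ x, ∑ y, pairWeight X σ x y * g y = 0 := by
      rw [Finset.sum_comm, ← h1]
      exact Finset.sum_congr rfl fun x _ => Finset.sum_congr rfl fun y _ => by
        rw [pairWeight_comm]
    have : ∀ x y, pairWeight X σ x y * ((g x - c) * (g y - c)) =
        pairWeight X σ x y * (g x * g y) - c * (pairWeight X σ x y * g x) -
          c * (pairWeight X σ x y * g y) + c ^ 2 * pairWeight X σ x y := fun x y => by ring
    simp only [this, Finset.sum_add_distrib, Finset.sum_sub_distrib, ← Finset.mul_sum, h1, h2, hrow]
    ring
  have hlow := hQ fun x => g x - c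
  rw [hshift, hmean, hsq] at hlow
  have hW : 0 ≤ c ^ 2 * ∑ x, linkWeight X σ x :=
    mul_nonneg (sq_nonneg _) (Finset.sum_nonneg fun x _ => linkWeight_nonneg x)
  have hV0 : 0 ≤ (V.card : ℝ) * c ^ 2 := by positivity
  have hfin : ((σ.card : ℝ) + 4) * ∑ x ∈ V, g x ^ 2 ≤ ∑ x, linkWeight X σ x * g x ^ 2 := by
    rw [Finset.mul_sum]
    refine (Finset.sum_le_sum fun x hx =>
      mul_le_mul_of_nonneg_right (hlink x hx) (sq_nonneg (g x))).trans ?_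
    exact Finset.sum_le_sum_of_subset_of_nonneg (Finset.subset_univ V) fun x _ _ =>
      mul_nonneg (linkWeight_nonneg x) (sq_nonneg _)
  rw [hkσ, one_mul, one_div, inv_mul_eq_div, le_div_iff₀ (by positivity)]
  refine le_trans ?_ hfin
  rw [mul_comm]
  exact mul_le_mul_of_nonneg_left (by linarith) (by positivity)

/-- Induction on the codimension: the constants `1/(|σ| + 4)` are matched to trickling down, each
being the image of the next under `γ ↦ γ/(1 - γ)`. -/
theorem CommonIndep.linkBound (hT : CommonIndep P₁ P₂ T)
    (hblocks : ∀ x y : E, x ≠ y → ¬ (P₁.SameBlock x y ∧ P₂.SameBlock x y))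
    (hk : 3 * k ≤ T.card) :
    ∀ (n : ℕ) (σ : Finset E), σ.card + n + 2 = k →
      LinkBound (commonIndepSets P₁ P₂ k) k σ (1 / ((σ.card : ℝ) + 4)) := by
  intro n
  induction n with
  | zero => exact fun σ hσ => hT.linkBound_of_card_add_two hblocks hk (by omega)
  | succ n ih =>
    intro σ hσ
    have hγ0 : (0 : ℝ) ≤ 1 / ((σ.card : ℝ) + 5) := by positivity
    have hγ1 : 1 / ((σ.card : ℝ) + 5) < 1 := by
      rw [div_lt_one (by positivity)]
      have : (0 : ℝ) ≤ σ.card := by positivity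
      linarith
    have hγ : (1 : ℝ) / ((σ.card : ℝ) + 4) =
        1 / ((σ.card : ℝ) + 5) / (1 - 1 / ((σ.card : ℝ) + 5)) := by
      have h1 : (1 : ℝ) - 1 / ((σ.card : ℝ) + 5) = (σ.card + 4) / (σ.card + 5) := by
        field_simp
        ring
      rw [h1]
      field_simp
    rw [hγ]
    refine LinkBound.trickle card_of_mem_commonIndepSets hγ0 hγ1 (by omega) ?_ ?_
    · intro g hg
      by_cases hex : ∃ x, linkWeight (commonIndepSets P₁ P₂ k) σ x ≠ 0
      · obtain ⟨y, hy⟩ := hex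
        refine ⟨g y, fun x hx => ?_⟩
        obtain ⟨hxσ, hxi⟩ := commonIndep_of_linkWeight_ne_zero hx
        obtain ⟨hyσ, hyi⟩ := commonIndep_of_linkWeight_ne_zero hy
        obtain ⟨z, hzx, hzy, hxz, hyz⟩ :=
          hT.exists_common_neighbour hxσ hyσ hxi hyi (by omega)
        have hadj : ∀ v, v ∉ σ → z ∉ insert v σ → CommonIndep P₁ P₂ (insert z (insert v σ)) →
            g v = g z := by
          intro v hv hzv hi
          refine hg v z ?_
          rw [pairWeight_of_notMem hv, linkWeight_of_notMem hzv]
          refine hT.card_cofaces_ne_zero (by omega) hi ?_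
          rw [Finset.card_insert_of_notMem hzv, Finset.card_insert_of_notMem hv]
          omega
        rw [hadj x hxσ hzx hxz, hadj y hyσ hzy hyz]
      · push Not at hex
        exact ⟨0, fun x hx => absurd (hex x) hx⟩
    · intro x hx
      have := ih (insert x σ) (by rw [Finset.card_insert_of_notMem hx]; omega)
      rw [Finset.card_insert_of_notMem hx] at this
      push_cast at this
      rwa [show (σ.card : ℝ) + 1 + 4 = σ.card + 5 by ring] at this

end CommonIndependentSets

/-! ### Second eigenvalue and Dirichlet form of the down-up walk. -/

/-- If the quadratic form of a real symmetric matrix is bounded by `θ` on the vectors with sum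
zero, then its second largest eigenvalue is at most `θ`. -/
theorem Matrix.IsHermitian.exists_eigenvaluesDesc_one_le {n : Type*} [Fintype n] [DecidableEq n]
    {A : Matrix n n ℝ} (hA : A.IsHermitian) (hn : 1 < Fintype.card n) {θ : ℝ}
    (h : ∀ f : n → ℝ, ∑ i, f i = 0 → f ⬝ᵥ A.mulVec f ≤ θ * (f ⬝ᵥ f)) :
    ∃ μ, (eigenvaluesDesc A)[1]? = some μ ∧ μ ≤ θ := by
  have hlist : eigenvaluesDesc A = List.ofFn hA.eigenvalues₀ := by
    rw [← hA.sort_roots_charpoly_eq_eigenvalues₀]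
    simp [eigenvaluesDesc]
  refine ⟨hA.eigenvalues₀ ⟨1, hn⟩, by rw [hlist]; simp [hn], ?_⟩
  set e : Fin (Fintype.card n) ≃ n := Fintype.equivOfCardEq (Fintype.card_fin _) with he
  have hev : ∀ i, hA.eigenvalues (e i) = hA.eigenvalues₀ i := fun i => by
    simp [Matrix.IsHermitian.eigenvalues, he]
  set p := e ⟨0, by omega⟩ with hp
  set q := e ⟨1, hn⟩ with hq
  have hpq : p ≠ q := by simp [hp, hq]
  have hle : hA.eigenvalues q ≤ hA.eigenvalues p := by
    rw [hev, hev]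
    exact hA.eigenvalues₀_antitone (by simp)
  rw [← hev, ← hq]
  have hdot : ∀ i j, (hA.eigenvectorBasis i).ofLp ⬝ᵥ (hA.eigenvectorBasis j).ofLp =
      if i = j then 1 else 0 := by
    intro i j
    rw [← orthonormal_iff_ite.1 hA.eigenvectorBasis.orthonormal i j,
      EuclideanSpace.inner_eq_star_dotProduct, dotProduct_comm]
    simp
  -- Courant–Fischer: the plane spanned by the top two eigenvectors contains a nonzero vector with
  -- sum zero, and on that plane the Rayleigh quotient is at least the second eigenvalue.
  obtain ⟨s, t, hst, hs⟩ : ∃ s t : ℝ, 0 < s ^ 2 + t ^ 2 ∧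
      s * ∑ i, (hA.eigenvectorBasis p).ofLp i + t * ∑ i, (hA.eigenvectorBasis q).ofLp i = 0 := by
    by_cases h0 : ∑ i, (hA.eigenvectorBasis p).ofLp i = 0
    · exact ⟨1, 0, by norm_num, by simp [h0]⟩
    · exact ⟨-∑ i, (hA.eigenvectorBasis q).ofLp i, ∑ i, (hA.eigenvectorBasis p).ofLp i, by positivity,
        by ring⟩
  have key := h (s • (hA.eigenvectorBasis p).ofLp + t • (hA.eigenvectorBasis q).ofLp) (by
    simp only [Pi.add_apply, Pi.smul_apply, smul_eq_mul, Finset.sum_add_distrib, ← Finset.mul_sum]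
    exact hs)
  simp only [Matrix.mulVec_add, Matrix.mulVec_smul, hA.mulVec_eigenvectorBasis] at key
  simp only [dotProduct_add, add_dotProduct, dotProduct_smul, smul_dotProduct, smul_eq_mul] at key
  simp only [hdot, hpq, hpq.symm, if_true, if_false] at key
  have h1 : hA.eigenvalues q * (s ^ 2 + t ^ 2) ≤ θ * (s ^ 2 + t ^ 2) := by
    nlinarith [mul_le_mul_of_nonneg_right hle (sq_nonneg s)]
  exact le_of_mul_le_mul_right h1 hst

namespace FaceComplex

variable {E : Type*} [Fintype E]

theorem card_of_mem_facesOfDim {C : FaceComplex E} {j : ℕ} :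
    ∀ β ∈ C.facesOfDim j, β.card = j + 1 := by
  intro β hβ
  simp only [facesOfDim, Finset.mem_filter] at hβ
  exact hβ.2.2

variable [DecidableEq E]

theorem sum_erase_eq_sum_powersetCard {α : Finset E} {j : ℕ} (hα : α.card = j + 1)
    (φ : Finset E → ℝ) : ∑ i ∈ α, φ (α.erase i) =
      ∑ τ ∈ (Finset.univ : Finset E).powersetCard j, if τ ⊆ α then φ τ else 0 := by
  rw [← Finset.sum_filter]
  refine Finset.sum_bij (fun i _ => α.erase i) ?_ ?_ ?_ fun _ _ => rfl
  · intro i hi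
    simp [Finset.mem_powersetCard, Finset.card_erase_of_mem hi, hα, Finset.erase_subset]
  · intro i hi i' hi' h
    exact (Finset.erase_inj α hi).1 h
  · intro τ hτ
    obtain ⟨hτ1, hτ2⟩ := Finset.mem_filter.1 hτ
    have hc := (Finset.mem_powersetCard.1 hτ1).2
    have h1 : (α \ τ).card = 1 := by
      rw [Finset.card_sdiff_of_subset hτ2]
      omega
    obtain ⟨i, hi⟩ := Finset.card_eq_one.1 h1
    have hi' : i ∈ α \ τ := by simp [hi]
    refine ⟨i, (Finset.mem_sdiff.1 hi').1, ?_⟩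
    rw [← Finset.sdiff_singleton_eq_erase, ← hi, Finset.sdiff_sdiff_eq_self hτ2]

/-- Summing over the intermediate sets `τ` makes the matrix visibly symmetric, so its spectrum is
real, and turns its quadratic form into a sum of squares. -/
theorem downUpWalk_apply (C : FaceComplex E) (j : ℕ) (α β : {α // α ∈ C.facesOfDim j}) :
    C.downUpWalk j α β = 1 / ((j : ℝ) + 1) *
      ∑ τ ∈ (Finset.univ : Finset E).powersetCard j,
        (if τ ⊆ α.1 then 1 else 0) * (if τ ⊆ β.1 then 1 else 0) *
          (1 / ((cofaces (C.facesOfDim j) τ).card : ℝ)) := by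
  have hα := card_of_mem_facesOfDim α.1 α.2
  unfold downUpWalk
  rw [← Finset.mul_sum, sum_erase_eq_sum_powersetCard hα fun τ =>
    if τ ⊆ β.1 then 1 / ((C.facesAbove j τ).card : ℝ) else 0, hα]
  push_cast
  congr 1
  refine Finset.sum_congr rfl fun τ _ => ?_
  simp only [facesAbove, cofaces]
  split_ifs <;> simp

theorem downUpWalk_isHermitian (C : FaceComplex E) (j : ℕ) : (C.downUpWalk j).IsHermitian := by
  ext α β
  rw [Matrix.conjTranspose_apply, star_trivial, downUpWalk_apply, downUpWalk_apply]
  congr 1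
  exact Finset.sum_congr rfl fun τ _ => by ring

theorem dotProduct_downUpWalk_mulVec (C : FaceComplex E) (j : ℕ)
    (f : {α // α ∈ C.facesOfDim j} → ℝ) :
    f ⬝ᵥ (C.downUpWalk j).mulVec f = 1 / ((j : ℝ) + 1) *
      ∑ τ ∈ (Finset.univ : Finset E).powersetCard j,
        (∑ α, if τ ⊆ α.1 then f α else 0) ^ 2 / (cofaces (C.facesOfDim j) τ).card := by
  set Y := (Finset.univ : Finset E).powersetCard j
  set N : Finset E → ℝ := fun τ => ((cofaces (C.facesOfDim j) τ).card : ℝ) with hN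
  have h1 : ∀ α β, f α * (C.downUpWalk j α β * f β) = ∑ τ ∈ Y, 1 / ((j : ℝ) + 1) *
      ((if τ ⊆ α.1 then f α else 0) * (if τ ⊆ β.1 then f β else 0) / N τ) := by
    intro α β
    rw [downUpWalk_apply, ← Finset.mul_sum, mul_left_comm, mul_assoc, Finset.sum_mul]
    congr 1
    refine Finset.sum_congr rfl fun τ _ => ?_
    split_ifs <;> ring
  calc f ⬝ᵥ (C.downUpWalk j).mulVec f = ∑ α, ∑ β, f α * (C.downUpWalk j α β * f β) := by
        simp only [dotProduct, Matrix.mulVec]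
        exact Finset.sum_congr rfl fun α _ => Finset.mul_sum _ _ _
    _ = ∑ τ ∈ Y, ∑ α, ∑ β, 1 / ((j : ℝ) + 1) *
        ((if τ ⊆ α.1 then f α else 0) * (if τ ⊆ β.1 then f β else 0) / N τ) := by
        symm
        rw [Finset.sum_comm]
        refine Finset.sum_congr rfl fun α _ => ?_
        rw [Finset.sum_comm]
        exact Finset.sum_congr rfl fun β _ => (h1 α β).symm
    _ = _ := by
        rw [Finset.mul_sum]
        refine Finset.sum_congr rfl fun τ _ => ?_
        rw [pow_two, Finset.sum_mul_sum]
        simp only [← Finset.mul_sum, ← Finset.sum_div, hN]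

/-- The Dirichlet form of the down-up walk is the average of the local variances. -/
theorem sum_cofaceVariance_eq (C : FaceComplex E) (j : ℕ) (F : Finset E → ℝ)
    {f : {α // α ∈ C.facesOfDim j} → ℝ} (hf : ∀ α, f α = F α.1) :
    ∑ τ ∈ (Finset.univ : Finset E).powersetCard j, cofaceVariance (C.facesOfDim j) F τ =
      ((j : ℝ) + 1) * (f ⬝ᵥ f - f ⬝ᵥ (C.downUpWalk j).mulVec f) := by
  have hcof : ∀ (G : Finset E → ℝ) (τ : Finset E), ∑ β ∈ cofaces (C.facesOfDim j) τ, G β =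
      ∑ α : {α // α ∈ C.facesOfDim j}, if τ ⊆ α.1 then G α.1 else 0 := by
    intro G τ
    rw [cofaces, Finset.sum_filter,
      Finset.sum_coe_sort (C.facesOfDim j) fun β => if τ ⊆ β then G β else 0]
  have h1 : ∑ τ ∈ (Finset.univ : Finset E).powersetCard j,
      ∑ β ∈ cofaces (C.facesOfDim j) τ, F β ^ 2 = ((j : ℝ) + 1) * (f ⬝ᵥ f) := by
    rw [Finset.sum_congr rfl fun τ _ => hcof (fun β => F β ^ 2) τ, Finset.sum_comm, dotProduct,
      Finset.mul_sum]
    refine Finset.sum_congr rfl fun α _ => ?_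
    have hα := card_of_mem_facesOfDim α.1 α.2
    rw [← sum_erase_eq_sum_powersetCard hα fun _ => F α.1 ^ 2, Finset.sum_const, hα, hf,
      nsmul_eq_mul, pow_two]
    push_cast
    rfl
  have hj : (j : ℝ) + 1 ≠ 0 := by positivity
  -- Sets `τ` contained in no face contribute `0`, by the convention for division by zero.
  unfold cofaceVariance
  rw [Finset.sum_sub_distrib, h1, mul_sub, dotProduct_downUpWalk_mulVec, ← mul_assoc,
    mul_one_div_cancel hj, one_mul]
  simp only [hcof, hf]

/-- Link bounds give a spectral gap of the down-up walk. -/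
theorem downUpWalk_dotProduct_le (C : FaceComplex E) (j : ℕ)
    (h : ∀ σ : Finset E, σ.card + 2 ≤ j + 1 →
      LinkBound (C.facesOfDim j) (j + 1) σ (1 / ((σ.card : ℝ) + 4)))
    (f : {α // α ∈ C.facesOfDim j} → ℝ) (hf : ∑ α, f α = 0) :
    f ⬝ᵥ (C.downUpWalk j).mulVec f ≤ (1 - 1 / ((j : ℝ) + 1) ^ 2) * (f ⬝ᵥ f) := by
  set F : Finset E → ℝ := fun α => if hα : α ∈ C.facesOfDim j then f ⟨α, hα⟩ else 0 with hF
  have hFf : f = fun α => F α.1 := by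
    funext α
    simp [hF]
  have hle := cofaceVariance_le_sum card_of_mem_facesOfDim F h j ∅ (by simp)
  have hdir := sum_cofaceVariance_eq C j F fun α => congrFun hFf α
  have hempty : ∀ Y : Finset (Finset E), cofaces Y ∅ = Y := fun Y => by simp [cofaces]
  have hV : cofaceVariance (C.facesOfDim j) F ∅ = f ⬝ᵥ f := by
    have h0 : ∑ β ∈ C.facesOfDim j, F β = 0 := by
      rw [← Finset.sum_coe_sort, ← hf, hFf]
    rw [cofaceVariance, hempty, h0, ← Finset.sum_coe_sort, hFf]
    simp [dotProduct, pow_two]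
  rw [hV, hempty, Nat.add_sub_cancel, hdir] at hle
  push_cast at hle
  set a := f ⬝ᵥ f with ha
  have ha0 : 0 ≤ a := Finset.sum_nonneg fun α _ => mul_self_nonneg _
  set c := f ⬝ᵥ (C.downUpWalk j).mulVec f
  have hj : (0 : ℝ) ≤ j := by positivity
  have h3 : 3 * a ≤ ((j : ℝ) + 3) * ((j + 1) * (a - c)) := by
    have e : ((j : ℝ) + 1 + 2) / (0 + 3) * ((j + 1) * (a - c)) =
      ((j : ℝ) + 3) * ((j + 1) * (a - c)) / 3 := by ring
    simp only [Finset.card_empty, Nat.cast_zero] at hle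
    rw [e] at hle
    linarith
  -- With `k = j + 1`, the gap `3/(k(k + 2))` is weakened to `1/k²` using `k + 2 ≤ 3k`; this
  -- requires `a - c ≥ 0`.
  have h4 : a ≤ ((j : ℝ) + 1) ^ 2 * (a - c) := by
    have h5 : 0 ≤ a - c := by
      by_contra hneg
      have : ((j : ℝ) + 3) * ((j + 1) * (a - c)) < 0 :=
        mul_neg_of_pos_of_neg (by positivity)
          (mul_neg_of_pos_of_neg (by positivity) (not_le.1 hneg))
      linarith
    have h6 : ((j : ℝ) + 3) * ((j + 1) * (a - c)) ≤ 3 * (((j : ℝ) + 1) ^ 2 * (a - c)) := by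
      have : 0 ≤ (j : ℝ) * ((j + 1) * (a - c)) := by positivity
      nlinarith
    linarith
  have h7 : a / ((j : ℝ) + 1) ^ 2 ≤ a - c := by
    rw [div_le_iff₀ (by positivity)]
    linarith
  have h8 : (1 - 1 / ((j : ℝ) + 1) ^ 2) * a = a - a / ((j : ℝ) + 1) ^ 2 := by ring
  rw [h8]
  linarith

end FaceComplex

/-! ### Assembly for the intersection of two partition matroids. -/

theorem facesOfDim_matroidIntersectionComplex {E : Type*} [Fintype E] [DecidableEq E]
    (P₁ P₂ : PartitionMatroid E) (j : ℕ) :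
    (matroidIntersectionComplex P₁.toMatroid P₂.toMatroid (j + 1)).facesOfDim j =
      commonIndepSets P₁ P₂ (j + 1) := by
  ext σ
  rw [mem_commonIndepSets]
  simp only [FaceComplex.facesOfDim, matroidIntersectionComplex, Finset.mem_filter,
    Finset.mem_univ, true_and, Set.mem_ofPred_eq, PartitionMatroid.toMatroid_indep, CommonIndep,
    PartitionMatroid.IsIndep]
  constructor
  · rintro ⟨⟨h1, h2, -⟩, h3⟩
    exact ⟨⟨h1, h2⟩, h3⟩
  · rintro ⟨⟨h1, h2⟩, h3⟩
    exact ⟨⟨h1, h2, h3.le⟩, h3⟩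

/-- Two disjoint `k`-subsets of `T` suffice; this guarantees that a second eigenvalue exists. -/
theorem CommonIndep.one_lt_card_commonIndepSets {E : Type*} [Fintype E] [DecidableEq E]
    {P₁ P₂ : PartitionMatroid E} {T : Finset E} {k : ℕ} (hT : CommonIndep P₁ P₂ T) (hk : 1 ≤ k)
    (hkT : 2 * k ≤ T.card) : 1 < (commonIndepSets P₁ P₂ k).card := by
  obtain ⟨α, hαT, hα⟩ := Finset.exists_subset_card_eq (show k ≤ T.card by omega)
  obtain ⟨β, hβT, hβ⟩ := Finset.exists_subset_card_eq (show k ≤ (T \ α).card by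
    rw [Finset.card_sdiff_of_subset hαT]; omega)
  refine Finset.one_lt_card.2 ⟨α, mem_commonIndepSets.2 ⟨hT.subset hαT, hα⟩, β,
    mem_commonIndepSets.2 ⟨hT.subset (hβT.trans Finset.sdiff_subset), hβ⟩, ?_⟩
  rintro rfl
  obtain ⟨x, hx⟩ := Finset.card_pos.1 (hα ▸ hk)
  exact (Finset.mem_sdiff.1 (hβT hx)).2 hx

theorem theoremt {E : Type*} [Fintype E] [DecidableEq E] (P₁ P₂ : PartitionMatroid E) (r k : ℕ)
    (hr : ∃ T : Finset E, P₁.toMatroid.Indep (T : Set E) ∧ P₂.toMatroid.Indep (T : Set E) ∧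
      T.card = r)
    (hblocks : ∀ x y : E, x ≠ y → ¬ (P₁.SameBlock x y ∧ P₂.SameBlock x y))
    (hk : 1 ≤ k) (hkr : (k : ℝ) ≤ (r : ℝ) / 3) :
    -- all eigenvalues of the walk are real, there are at least two of them,
    -- and the second largest one obeys the bound
    ((matroidIntersectionComplex P₁.toMatroid P₂.toMatroid k).downUpWalk
      (k - 1)).charpoly.Splits ∧
    ∃ lam₂ : ℝ,
      (eigenvaluesDesc ((matroidIntersectionComplex P₁.toMatroid P₂.toMatroid k).downUpWalk
        (k - 1)))[1]? = some lam₂ ∧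
      lam₂ ≤ 1 - 1 / (k : ℝ) ^ 2 := by
  obtain ⟨T, hT₁, hT₂, rfl⟩ := hr
  have hT : CommonIndep P₁ P₂ T :=
    ⟨(P₁.toMatroid_indep T).1 hT₁, (P₂.toMatroid_indep T).1 hT₂⟩
  have hkT : 3 * k ≤ T.card := by
    have : (3 : ℝ) * k ≤ T.card := by linarith
    exact_mod_cast this
  obtain ⟨j, rfl⟩ : ∃ j, k = j + 1 := ⟨k - 1, by omega⟩
  rw [Nat.add_sub_cancel]
  set C := matroidIntersectionComplex P₁.toMatroid P₂.toMatroid (j + 1)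
  have hfaces : C.facesOfDim j = commonIndepSets P₁ P₂ (j + 1) :=
    facesOfDim_matroidIntersectionComplex P₁ P₂ j
  refine ⟨(C.downUpWalk_isHermitian j).splits_charpoly, ?_⟩
  refine (C.downUpWalk_isHermitian j).exists_eigenvaluesDesc_one_le ?_ ?_
  · rw [Fintype.card_coe, hfaces]
    exact hT.one_lt_card_commonIndepSets hk (by omega)
  · intro f hf
    have := C.downUpWalk_dotProduct_le j (fun σ hσ => ?_) f hf
    · exact_mod_cast this
    · rw [hfaces]
      exact hT.linkBound hblocks hkT (j + 1 - 2 - σ.card) σ (by omega)
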